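/- Let $0<\alpha<1$ and $c_1=\frac12+\frac16\sqrt{12\alpha^{-1}-3}$ (so that $(\xi_1,\xi_2)=(c_1\xi,(1-c_1)\xi)$ solves $\xi^3=\alpha\xi_1^3+\alpha\xi_2^3$, $\xi=\xi_1+\xi_2$). For a real number $\rho$ and $\nu>0$ say that $\rho$ is of type $\nu$ if there is $K>0$ with $|\rho-\frac mn|\ge K|n|^{-2-\nu}$ for all integers $m$ and $n\neq0$; let $\nu_\rho\in[0,\infty]$ be $\infty$ if $\rho\in\mathbb Q$, and $\inf\{\nu>0:\rho\text{ is of type }\nu\}$ (with $\inf\emptyset=\infty$) if $\rho\notin\mathbb Q$. For $\lambda\ge1$ let $\mathbb T_\lambda=\mathbb R/2\pi\lambda\mathbb Z$, let $\widehat u(\xi,\tau)$, $(\xi,\tau)\in(\mathbb Z/\lambda)\times\mathbb R$, denote the space-time Fourier transform $\int_{\mathbb R}\int_0^{2\pi\lambda}e^{-i(x\xi+t\tau)}u(x,t)\,dx\,dt$, extended to distributions as usual, and let $\mathbb Z/\lambda$ carry $\frac1{2\pi\lambda}$ times the counting measure. With $\langle x\rangle=1+|x|$ put $$\|v\|_{Y^s_\alpha}=\big\|\langle\xi\rangle^s\langle\tau-\alpha\xi^3\rangle^{1/2}\,\widehat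 v\,\big\|_{L^2_{\xi,\tau}}+\big\|\langle\xi\rangle^s\,\widehat v\,\big\|_{L^2_\xi L^1_\tau},$$ $$\|u\|_{Z^s}=\big\|\langle\xi\rangle^s\langle\tau-\xi^3\rangle^{-1/2}\,\widehat u\,\big\|_{L^2_{\xi,\tau}}+\big\|\langle\xi\rangle^s\langle\tau-\xi^3\rangle^{-1}\,\widehat u\,\big\|_{L^2_\xi L^1_\tau}.$$ Let $s\in\mathbb R$ be such that $s\ge\min\big(1,\frac12+\frac12\nu_{c_1}+\delta\big)$ for some $\delta>0$. Then for every $\varepsilon>0$ there is a constant $C>0$, depending only on $\alpha$, $s$ and $\varepsilon$, such that for all $\lambda\ge1$ and all $v_1,v_2\in Y^s_\alpha(\mathbb T_\lambda\times\mathbb R)$, $$\|\partial_x(v_1v_2)\|_{Z^s(\mathbb T_\lambda\times\mathbb R)}\le C\,C_1(\lambda)\,\|v_1\|_{Y^s_\alpha(\mathbb T_\lambda\times\mathbb R)}\|v_2\|_{Y^s_\alpha(\mathbb T_\lambda\times\mathbb R)},$$ where $C_1(\lambda)=\lambda^{\frac12+\frac12\nu_{c_1}+\varepsilon}$ if $\nu_{c_1}<1$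 and $C_1(\lambda)=\lambda^{\varepsilon}$ if $\nu_{c_1}\ge1$. -/

import Mathlib

open MeasureTheory
open scoped ENNReal SchwartzMap

noncomputable section

namespace MajdaBiello

/-! ### Diophantine quantities -/

/-- `ρ` is of type `ν`: for some `K > 0`, `|ρ - m / n| ≥ K / |n| ^ (2 + ν)` for all integers
`m`, `n` with `n ≠ 0`. -/
def IsOfType (ρ ν : ℝ) : Prop :=
  ∃ K : ℝ, 0 < K ∧ ∀ m n : ℤ, n ≠ 0 →
    K / |(n : ℝ)| ^ (2 + ν) ≤ |ρ - (m : ℝ) / (n : ℝ)|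

open Classical in
/-- The minimal type index of a real number: `∞` for rational `ρ`, and otherwise the infimum in
`[0, ∞]` of all `ν > 0` such that `ρ` is of type `ν` (so `∞` if there is no such `ν`). -/
def minimalTypeIndex (ρ : ℝ) : ℝ≥0∞ :=
  if Irrational ρ then sInf (ENNReal.ofReal '' {ν : ℝ | 0 < ν ∧ IsOfType ρ ν}) else ⊤

/-- The larger root `c₁` of the resonance equation `1 - α c ^ 3 - α (1 - c) ^ 3 = 0`. -/
def c₁ (α : ℝ) : ℝ := 1 / 2 + Real.sqrt (-3 + 12 * α⁻¹) / 6

/-! ### Fourier analysis on `𝕋_L × ℝ`, where `𝕋_L = ℝ / 2πLℤ`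

Functions on `𝕋_L × ℝ` are functions of `(x, t) ∈ ℝ × ℝ` that are `2πL`-periodic in `x`. The
spatial frequencies are `ξ = k / L` with `k ∈ ℤ`, so a function of `(ξ, τ)` on the Fourier side is
written as `f : ℤ → ℝ → ℂ`, `f k τ` being its value at `(k / L, τ)`. -/

/-- One spatial period, `(0, 2πL] × ℝ`. -/
def strip (L : ℝ) : Set (ℝ × ℝ) := Set.Ioc 0 (2 * Real.pi * L) ×ˢ Set.univ

/-- Functionals on test functions on `𝕋_L × ℝ`. -/
abbrev Functional := (ℝ × ℝ → ℂ) → ℂ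

/-- The distribution on `𝕋_L × ℝ` given by a function `u`. -/
def ofFun (L : ℝ) (u : ℝ × ℝ → ℂ) : Functional :=
  fun φ => ∫ p in strip L, u p * φ p

/-- The distributional derivative `∂ₓ T`. -/
def distDx (T : Functional) : Functional :=
  fun φ => -T (fun p => deriv (fun x : ℝ => φ (x, p.2)) p.1)

/-- The test function `(x, t) ↦ e^{-i x k / L} ∫ e^{-i t τ} ψ(τ) dτ`. -/
def fourierTest (L : ℝ) (k : ℤ) (ψ : 𝓢(ℝ, ℂ)) : ℝ × ℝ → ℂ :=
  fun p => Complex.exp (-Complex.I * ((p.1 * (k / L) : ℝ) : ℂ)) *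
    ∫ τ : ℝ, Complex.exp (-Complex.I * ((p.2 * τ : ℝ) : ℂ)) * ψ τ

/-- The space-time Fourier transform of the distribution `T` on `𝕋_L × ℝ` is the function `f`.
The Fourier transform is the one normalised by `û(ξ, τ) = ∫∫ e^{-i (x ξ + t τ)} u(x, t) dx dt`,
extended to distributions by duality in `τ`. Such an `f` is unique up to null sets in `τ`. -/
def HasFourier (L : ℝ) (T : Functional) (f : ℤ → ℝ → ℂ) : Prop :=
  ∀ k : ℤ, AEStronglyMeasurable (f k) volume ∧
    ∀ ψ : 𝓢(ℝ, ℂ), Integrable (fun τ => f k τ * ψ τ) ∧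
      T (fourierTest L k ψ) = ∫ τ : ℝ, f k τ * ψ τ

/-- The bracket `⟨x⟩ = 1 + |x|`. -/
def bracket (x : ℝ) : ℝ := 1 + |x|

/-- `⟨ξ⟩^s ⟨τ - a ξ^3⟩^b |f(ξ, τ)|` at `ξ = k / L`, as an extended nonnegative real. -/
def weighted (L a s b : ℝ) (f : ℤ → ℝ → ℂ) (k : ℤ) (τ : ℝ) : ℝ≥0∞ :=
  ENNReal.ofReal (bracket (k / L) ^ s * bracket (τ - a * (k / L) ^ 3) ^ b * ‖f k τ‖)

/-- `‖⟨ξ⟩^s ⟨τ - a ξ^3⟩^b f‖` in `L²_ξ L²_τ`, where `ℤ / L` carries `(2πL)⁻¹` times the counting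
measure. -/
def normL2L2 (L a s b : ℝ) (f : ℤ → ℝ → ℂ) : ℝ≥0∞ :=
  (∑' k : ℤ, ENNReal.ofReal (2 * Real.pi * L)⁻¹ *
    ∫⁻ τ : ℝ, weighted L a s b f k τ ^ 2) ^ (1 / 2 : ℝ)

/-- `‖⟨ξ⟩^s ⟨τ - a ξ^3⟩^b f‖` in `L²_ξ L¹_τ`, with the same measure on `ℤ / L`. -/
def normL2L1 (L a s b : ℝ) (f : ℤ → ℝ → ℂ) : ℝ≥0∞ :=
  (∑' k : ℤ, ENNReal.ofReal (2 * Real.pi * L)⁻¹ *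
    (∫⁻ τ : ℝ, weighted L a s b f k τ) ^ 2) ^ (1 / 2 : ℝ)

/-- The norm of `Y_a^s(𝕋_L × ℝ)`, for the dispersion relation `τ = a ξ^3`. It is `∞` if the
Fourier transform of `T` is not a function; otherwise the infimum is over representatives of that
function, all of which give the same value. -/
def normY (L a s : ℝ) (T : Functional) : ℝ≥0∞ :=
  ⨅ (f : ℤ → ℝ → ℂ) (_ : HasFourier L T f), normL2L2 L a s (1 / 2) f + normL2L1 L a s 0 f

/-- The norm of `Z_a^s(𝕋_L × ℝ)`; see `normY` for the convention. The space `Z^s` is the case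
`a = 1`. -/
def normZ (L a s : ℝ) (T : Functional) : ℝ≥0∞ :=
  ⨅ (f : ℤ → ℝ → ℂ) (_ : HasFourier L T f), normL2L2 L a s (-1 / 2) f + normL2L1 L a s (-1) f

/-- Membership in `Y_a^s(𝕋_L × ℝ)` for `s ≥ 0`. As the weights `⟨ξ⟩^s ⟨τ - a ξ^3⟩^{1/2}` are at
least `1`, all elements of this space are functions in `L²(𝕋_L × ℝ)`. -/
def MemY (L a s : ℝ) (v : ℝ × ℝ → ℂ) : Prop :=
  (∀ x t : ℝ, v (x + 2 * Real.pi * L, t) = v (x, t)) ∧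
    MemLp v 2 (volume.restrict (strip L)) ∧ normY L a s (ofFun L v) < ⊤

open Classical in
/-- The power of the period in the bilinear estimate, `L^{1/2 + ν/2 + ε}` if `ν = ν_{c₁}` is less
than `1`, and `L^ε` otherwise. -/
def bilinearConst (α ε L : ℝ) : ℝ :=
  if minimalTypeIndex (c₁ α) < 1 then
    L ^ (1 / 2 + (minimalTypeIndex (c₁ α)).toReal / 2 + ε)
  else L ^ ε

end MajdaBiello

end

noncomputable section

namespace MajdaBiello

/-! ### Cauchy–Schwarz and Young inequalities for nonnegative functions -/

/-! On the Fourier side the product is a convolution over `ξ = ξ₁ + ξ₂`, `τ = τ₁ + τ₂`. The signed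
sum of the three modulations is the resonance function, which factors as `3αξ(ξ₁ - c₁ξ)(ξ₂ - c₁ξ)`.
So the square root of its bracket is at most the sum of the square roots of the three modulation
brackets, and each summand is paid for by one factor's weight or by the output weight. Young's
inequality in `τ` and Cauchy–Schwarz in `ξ₂` then reduce the estimate (`norm_conv_le`) to a bound,
uniform in `ξ`, for `L⁻¹ ∑ kernelSq` over `ξ₂ ∈ ℤ / L`; its square root is the constant of the
theorem.

That bound is `tsum_kernelSq_le`. Away from resonance (`ξ₁`, `ξ₂` both at distance at least `1` from
`c₁ξ`) the resonance function dominates `ξ²`, and the sum converges because `2s > 1`. Near resonance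
both inputs are comparable with the output, since `c₁ > 1`. If `s ≥ 1`, the kernel is bounded there
without any arithmetic. If `s < 1`, at distance at least `1/L` the kernel is `O(L)` on `O(L)`
frequencies of mass `1/L`. Within `1/L` only boundedly many frequencies remain, and there a type `ν`
of `c₁` keeps the resonance function away from zero: the kernel is `O(L^(2+ν))` when `1 + ν ≤ 2s`.
Altogether the sum is `O(L^(1+ν))`. The hypothesis on `s` supplies such a `ν` arbitrarily close to
the minimal index (`exists_isOfType`).

It remains to identify the distributional Fourier transform of `∂ₓ(v₁v₂)` (`hasFourier_distDx_mul`).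
For `s > 1/2` the transforms of `v₁`, `v₂` are integrable, so `v₂` equals its inversion integral
almost everywhere; inserting this in the pairing and using Fubini gives the convolution. -/

lemma lintegral_mul_sq_le {X : Type*} [MeasurableSpace X] (μ : Measure X) {f g : X → ℝ≥0∞}
    (hf : AEMeasurable f μ) (hg : AEMeasurable g μ) :
    (∫⁻ x, f x * g x ∂μ) ^ 2 ≤ (∫⁻ x, f x ^ 2 ∂μ) * ∫⁻ x, g x ^ 2 ∂μ := by
  have h := ENNReal.lintegral_mul_le_Lp_mul_Lq μ Real.HolderConjugate.two_two hf hg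
  simp only [Pi.mul_apply, ENNReal.rpow_two] at h
  calc (∫⁻ x, f x * g x ∂μ) ^ 2
      ≤ ((∫⁻ x, f x ^ 2 ∂μ) ^ (1 / 2 : ℝ) * (∫⁻ x, g x ^ 2 ∂μ) ^ (1 / 2 : ℝ)) ^ 2 := by gcongr
    _ = (∫⁻ x, f x ^ 2 ∂μ) * ∫⁻ x, g x ^ 2 ∂μ := by
      rw [mul_pow, ← ENNReal.rpow_two, ← ENNReal.rpow_two, ← ENNReal.rpow_mul, ← ENNReal.rpow_mul]
      norm_num

lemma tsum_mul_sq_le (c : ℝ≥0∞) (f g : ℤ → ℝ≥0∞) :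
    (∑' k, c * (f k * g k)) ^ 2 ≤ (∑' k, c * f k ^ 2) * ∑' k, c * g k ^ 2 := by
  have h := lintegral_mul_sq_le (c • (Measure.count : Measure ℤ))
    (f := f) (g := g) (measurable_of_countable _).aemeasurable (measurable_of_countable _).aemeasurable
  simpa only [lintegral_smul_measure, lintegral_count, smul_eq_mul, ← ENNReal.tsum_mul_left] using h

/-- The convolution of nonnegative functions on the line. -/
def lconv (A B : ℝ → ℝ≥0∞) (τ : ℝ) : ℝ≥0∞ := ∫⁻ σ, A (τ - σ) * B σ

lemma lconv_comm (A B : ℝ → ℝ≥0∞) (τ : ℝ) : lconv A B τ = lconv B A τ := by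
  unfold lconv
  rw [← lintegral_sub_left_eq_self _ τ]
  simp [mul_comm]

lemma measurable_lconv {A B : ℝ → ℝ≥0∞} (hA : Measurable A) (hB : Measurable B) :
    Measurable (lconv A B) := by
  unfold lconv
  apply Measurable.lintegral_prod_right'
    (f := fun p : ℝ × ℝ => A (p.1 - p.2) * B p.2)
  fun_prop

lemma lintegral_lconv {A B : ℝ → ℝ≥0∞} (hA : Measurable A) (hB : Measurable B) :
    ∫⁻ τ, lconv A B τ = (∫⁻ τ, A τ) * ∫⁻ τ, B τ := by
  unfold lconv
  rw [lintegral_lintegral_swap (by fun_prop)]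
  have h : ∀ σ, ∫⁻ τ, A (τ - σ) * B σ = (∫⁻ τ, A τ) * B σ := fun σ => by
    rw [lintegral_mul_const _ (show Measurable fun τ => A (τ - σ) by fun_prop),
      lintegral_sub_right_eq_self A]
  simp_rw [h]
  rw [lintegral_const_mul _ hB]

/-- Young's inequality `L² * L¹ → L²`: Cauchy–Schwarz for the measure `B dσ` bounds the square
pointwise by `(A² * B) ‖B‖₁`, which is then integrated in `τ`. -/
lemma lintegral_lconv_sq_le {A B : ℝ → ℝ≥0∞} (hA : Measurable A) (hB : Measurable B) :
    ∫⁻ τ, lconv A B τ ^ 2 ≤ (∫⁻ τ, A τ ^ 2) * (∫⁻ τ, B τ) ^ 2 := by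
  have key : ∀ τ, lconv A B τ ^ 2 ≤ lconv (fun x => A x ^ 2) B τ * ∫⁻ σ, B σ := by
    intro τ
    have h := lintegral_mul_sq_le (volume.withDensity B) (f := fun σ => A (τ - σ))
      (g := fun _ => 1) (by fun_prop) (by fun_prop)
    simp only [mul_one, one_pow] at h
    rw [lintegral_withDensity_eq_lintegral_mul _ hB (by fun_prop),
      lintegral_withDensity_eq_lintegral_mul _ hB (by fun_prop),
      lintegral_withDensity_eq_lintegral_mul _ hB (by fun_prop)] at h
    simpa [lconv, mul_comm] using h
  calc ∫⁻ τ, lconv A B τ ^ 2 ≤ ∫⁻ τ, lconv (fun x => A x ^ 2) B τ * ∫⁻ σ, B σ :=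
        lintegral_mono key
    _ = (∫⁻ τ, A τ ^ 2) * (∫⁻ τ, B τ) ^ 2 := by
      rw [lintegral_mul_const _ (measurable_lconv (hA.pow_const _) hB),
        lintegral_lconv (hA.pow_const _) hB, sq, mul_assoc]

lemma tsum_conv (a b : ℤ → ℝ≥0∞) :
    ∑' k, ∑' j, a (k - j) * b j = (∑' k, a k) * ∑' k, b k := by
  rw [ENNReal.tsum_comm]
  have h : ∀ j, ∑' k, a (k - j) = ∑' k, a k := fun j => (Equiv.subRight j).tsum_eq a
  simp_rw [ENNReal.tsum_mul_right, h, ENNReal.tsum_mul_left]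

/-! ### Weighted bilinear sums -/

section Bilinear

variable {ω D : ℝ≥0∞} {w : ℤ → ℤ → ℝ≥0∞} {a b : ℤ → ℝ≥0∞} {X : ℤ → ℤ → ℝ → ℝ≥0∞}

/-- In the applications `a` and `b` hold squared norms in `τ`, so after Cauchy–Schwarz in `j` only a
convolution of `ℓ¹` sequences is left. -/
lemma tsum_bilinear_le {S : ℤ → ℝ≥0∞}
    (hS : ∀ k, S k ≤ D * ∑' j, ω * (a (k - j) * b j)) :
    ∑' k, ω * S k ≤ D * ((∑' k, ω * a k) * ∑' k, ω * b k) := by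
  calc ∑' k, ω * S k ≤ ∑' k, ω * (D * ∑' j, ω * (a (k - j) * b j)) := by
        gcongr with k; exact hS k
    _ = D * ∑' k, ∑' j, (ω * a (k - j)) * (ω * b j) := by
      simp_rw [← ENNReal.tsum_mul_left]
      congr! 4
      ring
    _ = D * ((∑' k, ω * a k) * ∑' k, ω * b k) := by
      rw [tsum_conv (fun k => ω * a k) (fun k => ω * b k)]

theorem tsum_lintegral_sq_le (hw : ∀ k, ∑' j, ω * w k j ^ 2 ≤ D)
    (hm : ∀ k j, Measurable (X k j)) (hX : ∀ k j, ∫⁻ τ, X k j τ ^ 2 ≤ a (k - j) * b j) :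
    ∑' k, ω * ∫⁻ τ, (∑' j, ω * (w k j * X k j τ)) ^ 2
      ≤ D * ((∑' k, ω * a k) * ∑' k, ω * b k) := by
  refine tsum_bilinear_le fun k => ?_
  calc ∫⁻ τ, (∑' j, ω * (w k j * X k j τ)) ^ 2
      ≤ ∫⁻ τ, D * ∑' j, ω * X k j τ ^ 2 := by
        refine lintegral_mono fun τ => (tsum_mul_sq_le _ _ _).trans ?_
        gcongr
        exact hw k
    _ = D * ∑' j, ω * ∫⁻ τ, X k j τ ^ 2 := by
      have hm' : ∀ j, Measurable fun τ => X k j τ ^ 2 := fun j => (hm k j).pow_const 2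
      rw [lintegral_const_mul _ (Measurable.tsum fun j => (hm' j).const_mul _),
        lintegral_tsum fun j => ((hm' j).const_mul _).aemeasurable]
      simp_rw [lintegral_const_mul _ (hm' _)]
    _ ≤ _ := by
      gcongr with j
      exact hX k j

/-- The `L¹_τ` counterpart of `tsum_lintegral_sq_le`: the integral in `τ` is taken first, then
Cauchy–Schwarz is applied in `j`. -/
theorem tsum_sq_lintegral_le (hw : ∀ k, ∑' j, ω * w k j ^ 2 ≤ D)
    (hm : ∀ k j, Measurable (X k j)) (hX : ∀ k j, (∫⁻ τ, X k j τ) ^ 2 ≤ a (k - j) * b j) :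
    ∑' k, ω * (∫⁻ τ, ∑' j, ω * (w k j * X k j τ)) ^ 2
      ≤ D * ((∑' k, ω * a k) * ∑' k, ω * b k) := by
  refine tsum_bilinear_le fun k => ?_
  rw [lintegral_tsum fun j => (((hm k j).const_mul _).const_mul _).aemeasurable]
  simp_rw [lintegral_const_mul _ ((hm _ _).const_mul _), lintegral_const_mul _ (hm _ _)]
  refine (tsum_mul_sq_le _ _ _).trans ?_
  gcongr with j
  · exact hw k
  · exact hX k j

end Bilinear

/-! ### Riemann sums -/

/-- A sum over `ℤ / L` is at most the integral of any function dominating the summand on the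
adjacent cell. -/
lemma tsum_le_lintegral {L : ℝ} (hL : 0 < L) (φ : ℤ → ℝ≥0∞) (Φ : ℝ → ℝ≥0∞)
    (h : ∀ j : ℤ, ∀ x : ℝ, j / L ≤ x → x < (j + 1) / L → φ j ≤ Φ x) :
    ∑' j, ENNReal.ofReal L⁻¹ * φ j ≤ ∫⁻ x, Φ x := by
  have hd : Pairwise (Function.onFun Disjoint fun j : ℤ => Set.Ico ((j : ℝ) / L) ((j + 1) / L)) := by
    have := Set.pairwise_disjoint_Ico_intCast ℝ
    intro i j hij
    refine Set.disjoint_left.2 fun x hx hx' => ?_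
    refine Set.disjoint_left.1 (this hij) (show x * L ∈ _ from ?_) ?_
    · exact ⟨(div_le_iff₀ hL).1 hx.1, (lt_div_iff₀ hL).1 hx.2⟩
    · exact ⟨(div_le_iff₀ hL).1 hx'.1, (lt_div_iff₀ hL).1 hx'.2⟩
  calc ∑' j, ENNReal.ofReal L⁻¹ * φ j
      ≤ ∑' j : ℤ, ∫⁻ x in Set.Ico ((j : ℝ) / L) ((j + 1) / L), Φ x := by
        gcongr with j
        calc ENNReal.ofReal L⁻¹ * φ j
            = ∫⁻ x in Set.Ico ((j : ℝ) / L) ((j + 1) / L), φ j := by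
              rw [setLIntegral_const, Real.volume_Ico, mul_comm]
              congr 2
              field_simp
              ring
          _ ≤ _ := setLIntegral_mono' measurableSet_Ico fun x hx => h j x hx.1 hx.2
    _ = ∫⁻ x in ⋃ j : ℤ, Set.Ico ((j : ℝ) / L) ((j + 1) / L), Φ x :=
        (lintegral_iUnion (fun _ => measurableSet_Ico) hd _).symm
    _ ≤ ∫⁻ x, Φ x := setLIntegral_le_lintegral _ _

/-- The extra `1 / L` is the endpoint effect: a closed interval of length `2r` can hold `2rL + 1`
points of `ℤ / L`. -/
lemma tsum_indicator_le {L : ℝ} (hL : 0 < L) {r : ℝ} (y : ℝ) :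
    ∑' j : ℤ, ENNReal.ofReal L⁻¹ *
      (Set.Icc (y - r) (y + r)).indicator (fun _ => (1 : ℝ≥0∞)) (j / L)
      ≤ ENNReal.ofReal (2 * r + 1 / L) := by
  refine (tsum_le_lintegral hL _
    ((Set.Icc (y - r) (y + r + 1 / L)).indicator fun _ => 1) fun j x h1 h2 => ?_).trans ?_
  · by_cases hj : (j : ℝ) / L ∈ Set.Icc (y - r) (y + r)
    · rw [Set.indicator_of_mem hj, Set.indicator_of_mem]
      rw [add_div] at h2
      exact ⟨hj.1.trans h1, by linarith [hj.2]⟩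
    · simp [Set.indicator_of_notMem hj]
  · rw [lintegral_indicator measurableSet_Icc, setLIntegral_one, Real.volume_Icc]
    apply le_of_eq
    congr 1
    ring

lemma tsum_bracket_le {p : ℝ} (hp : 1 < p) :
    ∃ C : ℝ, 0 < C ∧ ∀ L : ℝ, 1 ≤ L →
      ∑' j : ℤ, ENNReal.ofReal L⁻¹ * ENNReal.ofReal (bracket (j / L) ^ (-p))
        ≤ ENNReal.ofReal C := by
  have hfin : ∫⁻ x : ℝ, ENNReal.ofReal ((1 + ‖x‖) ^ (-p)) < ⊤ :=
    finite_integral_one_add_norm (by simpa using hp)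
  set I := ∫⁻ x : ℝ, ENNReal.ofReal ((1 + ‖x‖) ^ (-p)) with hI
  refine ⟨2 ^ p * I.toReal + 1, by positivity, fun L hL => ?_⟩
  have hL0 : 0 < L := by linarith
  refine (tsum_le_lintegral hL0 _
    (fun x => ENNReal.ofReal (2 ^ p) * ENNReal.ofReal ((1 + ‖x‖) ^ (-p)))
    fun j x h1 h2 => ?_).trans ?_
  · rw [← ENNReal.ofReal_mul (by positivity)]
    apply ENNReal.ofReal_le_ofReal
    -- Cells have length `1 / L ≤ 1`, so brackets vary by at most a factor `2` on them. This makes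
    -- the constant independent of `L`.
    have hx : (1 + ‖x‖) / 2 ≤ bracket (j / L) := by
      unfold bracket
      rw [Real.norm_eq_abs]
      have h3 : 1 / L ≤ 1 := by rw [div_le_one hL0]; exact hL
      rw [add_div] at h2
      have : |x| ≤ |(j : ℝ) / L| + 1 := by
        rw [abs_le]
        constructor
        · linarith [neg_abs_le ((j : ℝ) / L)]
        · linarith [le_abs_self ((j : ℝ) / L)]
      linarith [abs_nonneg ((j : ℝ) / L)]
    calc bracket (j / L) ^ (-p) ≤ ((1 + ‖x‖) / 2) ^ (-p) :=
          Real.rpow_le_rpow_of_nonpos (by positivity) hx (by linarith)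
      _ = 2 ^ p * (1 + ‖x‖) ^ (-p) := by
        rw [Real.div_rpow (by positivity) (by positivity), Real.rpow_neg zero_le_two]
        field_simp
  · rw [lintegral_const_mul' _ _ ENNReal.ofReal_ne_top, ← hI,
      ← ENNReal.ofReal_toReal hfin.ne, ← ENNReal.ofReal_mul (by positivity)]
    apply ENNReal.ofReal_le_ofReal
    rw [ENNReal.toReal_ofReal ENNReal.toReal_nonneg]
    linarith

/-! ### The resonance function and the kernel of the bilinear estimate -/

lemma one_le_bracket (x : ℝ) : 1 ≤ bracket x := by simp [bracket]

lemma bracket_pos (x : ℝ) : 0 < bracket x := zero_lt_one.trans_le (one_le_bracket x)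

lemma bracket_add_le (x y : ℝ) : bracket (x + y) ≤ bracket x + bracket y := by
  unfold bracket
  linarith [abs_add_le x y]

@[fun_prop]
lemma measurable_bracket : Measurable bracket := by
  unfold bracket
  fun_prop

/-- This is where `α < 1` matters: both resonant ratios `c₁` and `1 - c₁` are then nonzero, so
resonant inputs are comparable with the output. -/
lemma one_lt_c₁ {α : ℝ} (hα₀ : 0 < α) (hα₁ : α < 1) : 1 < c₁ α := by
  have h : 1 < α⁻¹ := (one_lt_inv₀ hα₀).2 hα₁
  have : 3 < Real.sqrt (-3 + 12 * α⁻¹) := by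
    rw [Real.lt_sqrt (by norm_num)]
    linarith
  unfold c₁
  linarith

lemma three_mul_c₁ {α : ℝ} (hα₀ : 0 < α) (hα₁ : α < 1) :
    3 * α * (c₁ α ^ 2 - c₁ α) = 1 - α := by
  have h : 1 < α⁻¹ := (one_lt_inv₀ hα₀).2 hα₁
  have hs : Real.sqrt (-3 + 12 * α⁻¹) ^ 2 = -3 + 12 * α⁻¹ := Real.sq_sqrt (by linarith)
  have : c₁ α ^ 2 - c₁ α = (Real.sqrt (-3 + 12 * α⁻¹) ^ 2) / 36 - 1 / 4 := by
    unfold c₁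
    ring
  rw [this, hs]
  field_simp
  ring

/-- The resonance function `ξ ^ 3 - α ξ₁ ^ 3 - α ξ₂ ^ 3`, `ξ = ξ₁ + ξ₂`. -/
def resonance (α x y : ℝ) : ℝ := (x + y) ^ 3 - α * x ^ 3 - α * y ^ 3

lemma resonance_eq {α : ℝ} (hα₀ : 0 < α) (hα₁ : α < 1) (x y : ℝ) :
    resonance α x y = 3 * α * (x + y) * (x - c₁ α * (x + y)) * (y - c₁ α * (x + y)) := by
  unfold resonance
  linear_combination (-(x + y) ^ 3) * three_mul_c₁ hα₀ hα₁

/-- The square of the Fourier multiplier that remains after the largest modulation has been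
bounded below by the resonance function. -/
def kernelSq (α s x y : ℝ) : ℝ :=
  (x + y) ^ 2 * bracket (x + y) ^ (2 * s) /
    (bracket x ^ (2 * s) * bracket y ^ (2 * s) * bracket (resonance α x y))

lemma kernelSq_nonneg (α s x y : ℝ) : 0 ≤ kernelSq α s x y := by
  have := bracket_pos (x + y)
  have := bracket_pos x
  have := bracket_pos y
  have := bracket_pos (resonance α x y)
  unfold kernelSq
  positivity

/-- The larger input bracket absorbs `⟨x + y⟩^(2s)` up to the factor `2^(2s)`, which leaves the
inverse weight of the other input. -/
lemma kernelSq_le_of_nonresonant {α s M x y : ℝ} (hs : 0 ≤ s) (hM : 0 ≤ M)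
    (h : (x + y) ^ 2 ≤ M * bracket (resonance α x y)) :
    kernelSq α s x y ≤ M * 2 ^ (2 * s) * (bracket x ^ (-(2 * s)) + bracket y ^ (-(2 * s))) := by
  have hx := bracket_pos x
  have hy := bracket_pos y
  have hz := bracket_pos (x + y)
  have hr := bracket_pos (resonance α x y)
  have h1 : bracket (x + y) ^ (2 * s) ≤
      2 ^ (2 * s) * (bracket x ^ (2 * s) + bracket y ^ (2 * s)) := by
    have hX : 0 ≤ bracket x ^ (2 * s) := by positivity
    have hY : 0 ≤ bracket y ^ (2 * s) := by positivity
    rcases le_total (bracket x) (bracket y) with hxy | hxy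
    · calc bracket (x + y) ^ (2 * s) ≤ (2 * bracket y) ^ (2 * s) := by
            gcongr
            linarith [bracket_add_le x y]
        _ = 2 ^ (2 * s) * bracket y ^ (2 * s) := Real.mul_rpow zero_le_two hy.le
        _ ≤ _ := by gcongr; linarith
    · calc bracket (x + y) ^ (2 * s) ≤ (2 * bracket x) ^ (2 * s) := by
            gcongr
            linarith [bracket_add_le x y]
        _ = 2 ^ (2 * s) * bracket x ^ (2 * s) := Real.mul_rpow zero_le_two hx.le
        _ ≤ _ := by gcongr; linarith
  unfold kernelSq
  calc (x + y) ^ 2 * bracket (x + y) ^ (2 * s) /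
        (bracket x ^ (2 * s) * bracket y ^ (2 * s) * bracket (resonance α x y))
      ≤ (M * bracket (resonance α x y)) *
          (2 ^ (2 * s) * (bracket x ^ (2 * s) + bracket y ^ (2 * s))) /
        (bracket x ^ (2 * s) * bracket y ^ (2 * s) * bracket (resonance α x y)) := by gcongr
    _ = _ := by
      rw [Real.rpow_neg hx.le, Real.rpow_neg hy.le]
      field_simp
      ring

lemma kernelSq_le_of_comparable {α s κ x y : ℝ} (hs : 0 ≤ s) (hκ : 0 < κ)
    (hx : bracket (x + y) ≤ κ * bracket x) (hy : bracket (x + y) ≤ κ * bracket y) :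
    kernelSq α s x y ≤ κ ^ (2 * s) * κ ^ (2 * s) *
      ((x + y) ^ 2 * bracket (x + y) ^ (-(2 * s)) / bracket (resonance α x y)) := by
  have hx0 := bracket_pos x
  have hy0 := bracket_pos y
  have hz := bracket_pos (x + y)
  have hr := bracket_pos (resonance α x y)
  have h1 : bracket (x + y) ^ (2 * s) ≤ κ ^ (2 * s) * bracket x ^ (2 * s) := by
    rw [← Real.mul_rpow hκ.le hx0.le]
    gcongr
  have h2 : bracket (x + y) ^ (2 * s) ≤ κ ^ (2 * s) * bracket y ^ (2 * s) := by
    rw [← Real.mul_rpow hκ.le hy0.le]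
    gcongr
  rw [Real.rpow_neg hz.le]
  unfold kernelSq
  have hX : 0 < bracket x ^ (2 * s) := by positivity
  have hY : 0 < bracket y ^ (2 * s) := by positivity
  have hZ : 0 < bracket (x + y) ^ (2 * s) := by positivity
  have h3 := mul_le_mul h1 h2 hZ.le (by positivity)
  rw [div_le_iff₀ (by positivity)]
  have e : κ ^ (2 * s) * κ ^ (2 * s) *
      ((x + y) ^ 2 * (bracket (x + y) ^ (2 * s))⁻¹ / bracket (resonance α x y)) *
      (bracket x ^ (2 * s) * bracket y ^ (2 * s) * bracket (resonance α x y)) =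
      (x + y) ^ 2 * (κ ^ (2 * s) * bracket x ^ (2 * s) * (κ ^ (2 * s) * bracket y ^ (2 * s))) /
        bracket (x + y) ^ (2 * s) := by
    field_simp
  rw [e, le_div_iff₀ hZ, mul_assoc]
  gcongr

/-- Write `x = cξ + θ` and `y = (1 - c)ξ - θ` with `ξ = x + y` and `|θ| < 1`; both coefficients of
`ξ` are nonzero. -/
lemma bracket_le_of_near {c x y : ℝ} (hc : 1 < c) (h : |x - c * (x + y)| < 1) :
    bracket (x + y) ≤ (2 + (c - 1)⁻¹) * bracket x ∧
      bracket (x + y) ≤ (2 + (c - 1)⁻¹) * bracket y := by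
  have hc' : 0 < c - 1 := by linarith
  have hi : 0 < (c - 1)⁻¹ := inv_pos.2 hc'
  have h1 : c * |x + y| ≤ bracket x := by
    have h2 := abs_add_le (c * (x + y) - x) x
    rw [abs_sub_comm] at h2
    rw [sub_add_cancel, abs_mul, abs_of_pos (by linarith : 0 < c)] at h2
    unfold bracket
    linarith
  have h2 : (c - 1) * |x + y| ≤ bracket y := by
    have h2 := abs_add_le (-(x - c * (x + y))) (-y)
    rw [abs_neg, abs_neg, show -(x - c * (x + y)) + -y = (c - 1) * (x + y) by ring, abs_mul,
      abs_of_pos hc'] at h2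
    unfold bracket
    linarith
  have h3 : |x + y| ≤ (c - 1)⁻¹ * bracket y := by
    rw [inv_mul_eq_div, le_div_iff₀ hc']
    linarith
  have h4 : |x + y| ≤ bracket x := by nlinarith [abs_nonneg (x + y)]
  have h5 : bracket (x + y) = 1 + |x + y| := rfl
  have := one_le_bracket x
  have := one_le_bracket y
  constructor
  · nlinarith
  · nlinarith

/-- If both frequencies are at distance at least `d` from the resonant ones, then the resonance
function is at least a multiple of `d ξ ^ 2`. -/
lemma resonance_lower {α d x y : ℝ} (hα₀ : 0 < α) (hα₁ : α < 1) (hd : 0 ≤ d)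
    (hx : d ≤ |x - c₁ α * (x + y)|) (hy : d ≤ |y - c₁ α * (x + y)|) :
    3 * α / 2 * (x + y) ^ 2 * d ≤ |resonance α x y| := by
  have hc := one_lt_c₁ hα₀ hα₁
  -- The two distances add up to at least `(2c₁ - 1)|x + y| ≥ |x + y|`, and each is at least `d`, so
  -- `(A + B)d ≤ 2AB`.
  have key : |x + y| * d ≤ 2 * (|x - c₁ α * (x + y)| * |y - c₁ α * (x + y)|) := by
    have h := abs_add_le (-(x - c₁ α * (x + y))) (-(y - c₁ α * (x + y)))
    rw [abs_neg, abs_neg, show -(x - c₁ α * (x + y)) + -(y - c₁ α * (x + y)) =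
      (2 * c₁ α - 1) * (x + y) by ring, abs_mul, abs_of_pos (by linarith)] at h
    have h' : |x + y| ≤ |x - c₁ α * (x + y)| + |y - c₁ α * (x + y)| := by
      nlinarith [abs_nonneg (x + y)]
    nlinarith
  rw [resonance_eq hα₀ hα₁, abs_mul, abs_mul, abs_mul, abs_of_pos (by positivity : 0 < 3 * α),
    ← sq_abs (x + y)]
  have h := mul_le_mul_of_nonneg_left key (by positivity : 0 ≤ 3 * α / 2 * |x + y|)
  linarith

/-- The lower bound that a type condition gives for the distance from the resonant frequency. -/
lemma IsOfType.lower {c ν : ℝ} (h : IsOfType c ν) :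
    ∃ K : ℝ, 0 < K ∧ ∀ L : ℝ, 1 ≤ L → ∀ m n : ℤ, n ≠ 0 →
      K * |(n : ℝ) / L| ^ (-1 - ν) * L ^ (-2 - ν) ≤ |(m : ℝ) / L - c * (n / L)| := by
  obtain ⟨K, hK, h⟩ := h
  refine ⟨K, hK, fun L hL m n hn => ?_⟩
  have hL0 : 0 < L := by linarith
  have hn' : 0 < |(n : ℝ)| := by simpa using hn
  have hn0 : (n : ℝ) ≠ 0 := by exact_mod_cast hn
  have e : |(m : ℝ) / L - c * (n / L)| = |(n : ℝ)| / L * |c - m / n| := by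
    rw [← abs_of_pos hL0, ← abs_div, abs_of_pos hL0, ← abs_mul, abs_sub_comm]
    congr 1
    field_simp
  rw [e]
  refine le_trans (le_of_eq ?_) (mul_le_mul_of_nonneg_left (h m n hn) (by positivity))
  rw [abs_div, abs_of_pos hL0, Real.div_rpow hn'.le hL0.le,
    show -1 - ν = 1 - (2 + ν) by ring, show -2 - ν = (1 - (2 + ν)) - 1 by ring,
    Real.rpow_sub_one hL0.ne', Real.rpow_sub hn', Real.rpow_one]
  have := (Real.rpow_pos_of_pos hL0 (1 - (2 + ν))).ne'
  field_simp

/-- The three alternatives are nonresonant, near resonance, and within one lattice spacing of it.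
The parameter `Λ` is the target size of the kernel sum; the last bound may lose a factor `L` because
it concerns only boundedly many frequencies of mass `1 / L`. -/
lemma kernelSq_cases {α s ν : ℝ} (hα₀ : 0 < α) (hα₁ : α < 1) (hs : 1 / 2 < s)
    (hν : s < 1 → 0 ≤ ν ∧ IsOfType (c₁ α) ν ∧ 1 + ν ≤ 2 * s) :
    ∃ C : ℝ, 0 < C ∧ ∀ L : ℝ, 1 ≤ L → ∀ Λ : ℝ, 1 ≤ Λ → (s < 1 → L ^ (1 + ν) ≤ Λ) →
      ∀ k j : ℤ, ∀ x y : ℝ, x = ((k - j : ℤ) : ℝ) / L → y = (j : ℝ) / L →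
      kernelSq α s x y ≤ C * (bracket x ^ (-(2 * s)) + bracket y ^ (-(2 * s))) ∨
      ((|x - c₁ α * (x + y)| ≤ 1 ∨ |y - c₁ α * (x + y)| ≤ 1) ∧ kernelSq α s x y ≤ C * Λ) ∨
      ((|x - c₁ α * (x + y)| ≤ 1 / L ∨ |y - c₁ α * (x + y)| ≤ 1 / L) ∧
        kernelSq α s x y ≤ C * (L * Λ)) := by
  have hc := one_lt_c₁ hα₀ hα₁
  obtain ⟨K, hK, hKl⟩ : ∃ K : ℝ, 0 < K ∧ (s < 1 → ∀ L : ℝ, 1 ≤ L → ∀ m n : ℤ, n ≠ 0 →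
      K * |(n : ℝ) / L| ^ (-1 - ν) * L ^ (-2 - ν) ≤ |(m : ℝ) / L - c₁ α * (n / L)|) := by
    by_cases h : s < 1
    · obtain ⟨K, hK, h'⟩ := (hν h).2.1.lower
      exact ⟨K, hK, fun _ => h'⟩
    · exact ⟨1, one_pos, fun h' => absurd h' h⟩
  set κ := 2 + (c₁ α - 1)⁻¹ with hκ
  have hκ0 : 0 < κ := by
    have : 0 < (c₁ α - 1)⁻¹ := inv_pos.2 (by linarith)
    positivity
  set M := 2 / (3 * α) with hM
  have hM0 : 0 < M := by positivity
  have hMα : M * (3 * α / 2) = 1 := by rw [hM]; field_simp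
  set E := κ ^ (2 * s) * κ ^ (2 * s) with hE
  have hE0 : 0 < E := by positivity
  -- The first term serves the nonresonant case. The summands `1`, `M`, `M / K` serve the
  -- near-resonant ones: `s ≥ 1`, distance at least `1 / L`, distance below `1 / L`.
  refine ⟨M * 2 ^ (2 * s) + E * (1 + M + M / K), by positivity, ?_⟩
  intro L hL Λ hΛ hLΛ k j x y hx hy
  have hL0 : 0 < L := by linarith
  have hxy : x + y = k / L := by
    rw [hx, hy]
    push_cast
    ring
  have hbx := bracket_pos x
  have hby := bracket_pos y
  have hbz := bracket_pos (x + y)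
  have hbz1 := one_le_bracket (x + y)
  have hr := bracket_pos (resonance α x y)
  have hr1 := one_le_bracket (resonance α x y)
  have hrabs : |resonance α x y| ≤ bracket (resonance α x y) := by simp [bracket]
  by_cases hnear : |x - c₁ α * (x + y)| < 1 ∨ |y - c₁ α * (x + y)| < 1
  swap
  · left
    push Not at hnear
    have h1 := resonance_lower hα₀ hα₁ zero_le_one hnear.1 hnear.2
    refine (kernelSq_le_of_nonresonant (by linarith) hM0.le ?_).trans ?_
    · have := mul_le_mul_of_nonneg_left (h1.trans hrabs) hM0.le
      calc (x + y) ^ 2 = M * (3 * α / 2 * (x + y) ^ 2 * 1) := by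
            linear_combination (-(x + y) ^ 2) * hMα
        _ ≤ _ := this
    · gcongr
      have : 0 < E * (1 + M + M / K) := by positivity
      linarith
  right
  have hcomp : bracket (x + y) ≤ κ * bracket x ∧ bracket (x + y) ≤ κ * bracket y := by
    rcases hnear with h | h
    · exact bracket_le_of_near hc h
    · rw [add_comm x y] at h ⊢
      exact (bracket_le_of_near hc h).symm
  have hQ := kernelSq_le_of_comparable (α := α) (by linarith : 0 ≤ s) hκ0 hcomp.1 hcomp.2
  rw [← hE] at hQ
  set R := (x + y) ^ 2 * bracket (x + y) ^ (-(2 * s)) / bracket (resonance α x y) with hR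
  have hCE : ∀ a b : ℝ, 0 ≤ b → a ≤ 1 + M + M / K → R ≤ a * b →
      kernelSq α s x y ≤ (M * 2 ^ (2 * s) + E * (1 + M + M / K)) * b := by
    intro a b hb ha hRa
    refine hQ.trans ?_
    calc E * R ≤ E * ((1 + M + M / K) * b) := by gcongr; exact hRa.trans (by gcongr)
      _ ≤ _ := by
        have : 0 ≤ M * 2 ^ (2 * s) * b := by positivity
        linarith
  have hbneg : bracket (x + y) ^ (-(2 * s)) ≤ 1 :=
    Real.rpow_le_one_of_one_le_of_nonpos hbz1 (by linarith)
  have hMK : 0 < M / K := by positivity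
  have hsq : (x + y) ^ 2 ≤ bracket (x + y) ^ 2 := by
    rw [← sq_abs]
    gcongr
    simp [bracket]
  rcases le_or_gt 1 s with hs1 | hs1
  · left
    refine ⟨hnear.imp le_of_lt le_of_lt, hCE 1 Λ (by linarith) (by linarith) ?_⟩
    rw [hR, div_le_iff₀ hr, Real.rpow_neg hbz.le, ← div_eq_mul_inv,
      div_le_iff₀ (by positivity)]
    have h2 : bracket (x + y) ^ 2 ≤ bracket (x + y) ^ (2 * s) := by
      rw [← Real.rpow_two]
      exact Real.rpow_le_rpow_of_exponent_le hbz1 (by linarith)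
    have h3 : 1 ≤ 1 * Λ * bracket (resonance α x y) := by nlinarith
    nlinarith [Real.rpow_pos_of_pos hbz (2 * s)]
  obtain ⟨hν0, -, hνs⟩ := hν hs1
  have hLΛ := hLΛ hs1
  by_cases hclose : |x - c₁ α * (x + y)| < 1 / L ∨ |y - c₁ α * (x + y)| < 1 / L
  swap
  · left
    push Not at hclose
    refine ⟨hnear.imp le_of_lt le_of_lt, hCE M Λ (by linarith) (by linarith) ?_⟩
    have h1 := (resonance_lower hα₀ hα₁ (by positivity) hclose.1 hclose.2).trans hrabs
    have hLL : L ≤ Λ := by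
      refine le_trans ?_ hLΛ
      calc L = L ^ (1 : ℝ) := (Real.rpow_one L).symm
        _ ≤ _ := Real.rpow_le_rpow_of_exponent_le hL (by linarith)
    rw [hR, div_le_iff₀ hr]
    calc (x + y) ^ 2 * bracket (x + y) ^ (-(2 * s)) ≤ (x + y) ^ 2 * 1 := by gcongr
      _ = M * L * (3 * α / 2 * (x + y) ^ 2 * (1 / L)) := by
        have : L * (1 / L) = 1 := by field_simp
        linear_combination (-(x + y) ^ 2) * hMα - M * (3 * α / 2) * (x + y) ^ 2 * this
      _ ≤ M * Λ * bracket (resonance α x y) := by gcongr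
  right
  refine ⟨hclose.imp le_of_lt le_of_lt, hCE (M / K) (L * Λ) (by positivity) (by linarith) ?_⟩
  -- The type condition is void at `n = 0`, but there the derivative makes the kernel vanish.
  by_cases hk : k = 0
  · have : x + y = 0 := by rw [hxy, hk]; simp
    rw [hR, this]
    simp only [ne_eq, OfNat.ofNat_ne_zero, not_false_eq_true, zero_pow, zero_mul, zero_div]
    positivity
  have hz0 : 0 < |x + y| := by
    rw [hxy]
    have : (k : ℝ) ≠ 0 := by exact_mod_cast hk
    positivity
  have h1 := hKl hs1 L hL (k - j) k hk
  have h2 := hKl hs1 L hL j k hk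
  rw [← hx, ← hxy] at h1
  rw [← hy, ← hxy] at h2
  have h3 := (resonance_lower hα₀ hα₁ (by positivity) h1 h2).trans hrabs
  -- The regularity threshold enters here: `1 + ν ≤ 2s` lets `⟨ξ⟩^(-2s)` absorb the growth
  -- `|ξ|^(1+ν)` lost in the Diophantine bound.
  have hP : |x + y| ^ (1 + ν) * bracket (x + y) ^ (-(2 * s)) ≤ 1 := by
    rw [Real.rpow_neg hbz.le, ← div_eq_mul_inv, div_le_one (by positivity)]
    calc |x + y| ^ (1 + ν) ≤ bracket (x + y) ^ (1 + ν) := by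
          gcongr
          simp [bracket]
      _ ≤ _ := Real.rpow_le_rpow_of_exponent_le hbz1 hνs
  have e1 : |x + y| ^ (-1 - ν) * |x + y| ^ (1 + ν) = 1 := by
    rw [← Real.rpow_add hz0]
    norm_num
  have e2 : L ^ (-2 - ν) * (L * L ^ (1 + ν)) = 1 := by
    rw [← Real.rpow_one_add' hL0.le (by linarith), ← Real.rpow_add hL0]
    ring_nf
    simp
  have e3 : K * K⁻¹ = 1 := mul_inv_cancel₀ hK.ne'
  rw [hR, div_le_iff₀ hr]
  set P := |x + y| ^ (1 + ν)
  set P' := |x + y| ^ (-1 - ν)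
  set B := bracket (x + y) ^ (-(2 * s))
  set T := L ^ (1 + ν)
  set T' := L ^ (-2 - ν)
  have hL3 : 0 ≤ 3 * α / 2 * (x + y) ^ 2 * (K * P' * T') := by positivity
  calc (x + y) ^ 2 * B
      = M * K⁻¹ * (L * T) * (P * B) * (3 * α / 2 * (x + y) ^ 2 * (K * P' * T')) := by
        calc (x + y) ^ 2 * B = (x + y) ^ 2 * B * (M * (3 * α / 2)) * (K * K⁻¹) *
              (T' * (L * T)) * (P' * P) := by rw [hMα, e1, e2, e3]; ring
          _ = _ := by ring
    _ ≤ M * K⁻¹ * (L * Λ) * 1 * bracket (resonance α x y) := by gcongr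
    _ = M / K * (L * Λ) * bracket (resonance α x y) := by ring

/-- The kernel is bounded in `L²` of one frequency, uniformly in the other. -/
theorem tsum_kernelSq_le {α s ν : ℝ} (hα₀ : 0 < α) (hα₁ : α < 1) (hs : 1 / 2 < s)
    (hν : s < 1 → 0 ≤ ν ∧ IsOfType (c₁ α) ν ∧ 1 + ν ≤ 2 * s) :
    ∃ C : ℝ, 0 < C ∧ ∀ L : ℝ, 1 ≤ L → ∀ Λ : ℝ, 1 ≤ Λ → (s < 1 → L ^ (1 + ν) ≤ Λ) →
      ∀ k : ℤ, ∑' j : ℤ, ENNReal.ofReal L⁻¹ *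
        ENNReal.ofReal (kernelSq α s (((k - j : ℤ) : ℝ) / L) ((j : ℝ) / L))
          ≤ ENNReal.ofReal (C * Λ) := by
  obtain ⟨C, hC, hcases⟩ := kernelSq_cases hα₀ hα₁ hs hν
  obtain ⟨C', hC', hbr⟩ := tsum_bracket_le (p := 2 * s) (by linarith)
  -- `2C'` comes from the two bracket sums. The two unit intervals give at most `6Λ`, and the two
  -- intervals of radius `1 / L` give `2 · (3 / L) · LΛ = 6Λ`.
  refine ⟨C * (2 * C' + 12), by positivity, fun L hL Λ hΛ hLΛ k => ?_⟩
  have hL0 : 0 < L := by linarith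
  set c := c₁ α
  -- The condition that `ξ₁ = ξ - ξ₂` is near `cξ` is rewritten for the summation variable: `ξ₂` is
  -- near `(1 - c)ξ`.
  set y₁ := (1 - c) * (k / L) with hy₁
  set y₂ := c * (k / L) with hy₂
  let ι : ℝ → ℝ → ℤ → ℝ≥0∞ := fun r y j =>
    (Set.Icc (y - r) (y + r)).indicator (fun _ => (1 : ℝ≥0∞)) (j / L)
  have hι : ∀ r y, ∑' j, ENNReal.ofReal L⁻¹ * ι r y j ≤ ENNReal.ofReal (2 * r + 1 / L) :=
    fun r y => tsum_indicator_le hL0 y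
  have hι1 : ∀ (r y : ℝ) (j : ℤ), |(j : ℝ) / L - y| ≤ r → ι r y j = 1 := by
    intro r y j h
    refine Set.indicator_of_mem ?_ _
    rw [abs_le] at h
    exact ⟨by linarith, by linarith⟩
  let β : ℤ → ℝ≥0∞ := fun j => ENNReal.ofReal (bracket (j / L) ^ (-(2 * s)))
  have hβ : ∑' j, ENNReal.ofReal L⁻¹ * β j ≤ ENNReal.ofReal C' := hbr L hL
  have hβ' : ∑' j, ENNReal.ofReal L⁻¹ * β (k - j) ≤ ENNReal.ofReal C' := by
    exact ((Equiv.subLeft k).tsum_eq fun j => ENNReal.ofReal L⁻¹ * β j).trans_le hβ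
  have hpt : ∀ j : ℤ, ENNReal.ofReal (kernelSq α s (((k - j : ℤ) : ℝ) / L) ((j : ℝ) / L)) ≤
      ENNReal.ofReal C * (β (k - j) + β j + ENNReal.ofReal Λ * (ι 1 y₁ j + ι 1 y₂ j) +
        ENNReal.ofReal (L * Λ) * (ι (1 / L) y₁ j + ι (1 / L) y₂ j)) := by
    intro j
    have hsum : (((k - j : ℤ) : ℝ) / L) + (j : ℝ) / L = k / L := by
      push_cast
      ring
    have hd₁ : |((k - j : ℤ) : ℝ) / L - c * (k / L)| = |(j : ℝ) / L - y₁| := by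
      rw [abs_sub_comm]
      congr 1
      rw [hy₁]
      push_cast
      ring
    have h := hcases L hL Λ hΛ hLΛ k j _ _ rfl rfl
    rw [hsum, hd₁] at h
    rcases h with h | ⟨h1, h⟩ | ⟨h1, h⟩
    · refine (ENNReal.ofReal_le_ofReal h).trans ?_
      rw [ENNReal.ofReal_mul hC.le, ENNReal.ofReal_add
        (Real.rpow_nonneg (bracket_pos _).le _) (Real.rpow_nonneg (bracket_pos _).le _)]
      gcongr ENNReal.ofReal C * ?_
      rw [add_assoc]
      exact le_self_add
    · refine (ENNReal.ofReal_le_ofReal h).trans ?_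
      rw [ENNReal.ofReal_mul hC.le]
      gcongr
      have : 1 ≤ ι 1 y₁ j + ι 1 y₂ j := by
        rcases h1 with h1 | h1
        · rw [hι1 _ _ _ h1]; exact le_self_add
        · rw [hι1 _ _ _ h1]; exact le_add_self
      calc ENNReal.ofReal Λ ≤ ENNReal.ofReal Λ * (ι 1 y₁ j + ι 1 y₂ j) := le_mul_of_one_le_right' this
        _ ≤ _ := le_add_self.trans le_self_add
    · refine (ENNReal.ofReal_le_ofReal h).trans ?_
      rw [ENNReal.ofReal_mul hC.le]
      gcongr
      have : 1 ≤ ι (1 / L) y₁ j + ι (1 / L) y₂ j := by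
        rcases h1 with h1 | h1
        · rw [hι1 _ _ _ h1]; exact le_self_add
        · rw [hι1 _ _ _ h1]; exact le_add_self
      calc ENNReal.ofReal (L * Λ) ≤ ENNReal.ofReal (L * Λ) * (ι (1 / L) y₁ j + ι (1 / L) y₂ j) :=
            le_mul_of_one_le_right' this
        _ ≤ _ := le_add_self
  set o := ENNReal.ofReal L⁻¹
  have hLi : 1 / L ≤ 1 := by rw [div_le_one hL0]; exact hL
  calc ∑' j : ℤ, o * ENNReal.ofReal (kernelSq α s (((k - j : ℤ) : ℝ) / L) ((j : ℝ) / L))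
      ≤ ∑' j : ℤ, o * (ENNReal.ofReal C * (β (k - j) + β j +
        ENNReal.ofReal Λ * (ι 1 y₁ j + ι 1 y₂ j) +
        ENNReal.ofReal (L * Λ) * (ι (1 / L) y₁ j + ι (1 / L) y₂ j))) := by
        gcongr with j
        exact hpt j
    _ = ENNReal.ofReal C * (∑' j, o * β (k - j) + ∑' j, o * β j +
        ENNReal.ofReal Λ * (∑' j, o * ι 1 y₁ j + ∑' j, o * ι 1 y₂ j) +
        ENNReal.ofReal (L * Λ) * (∑' j, o * ι (1 / L) y₁ j + ∑' j, o * ι (1 / L) y₂ j)) := by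
      simp_rw [← ENNReal.tsum_add, ← ENNReal.tsum_mul_left, ← ENNReal.tsum_add,
        ← ENNReal.tsum_mul_left]
      congr 1
      ext j
      ring
    _ ≤ ENNReal.ofReal C * (ENNReal.ofReal C' + ENNReal.ofReal C' +
        ENNReal.ofReal Λ * (ENNReal.ofReal (2 * 1 + 1 / L) + ENNReal.ofReal (2 * 1 + 1 / L)) +
        ENNReal.ofReal (L * Λ) * (ENNReal.ofReal (2 * (1 / L) + 1 / L) +
          ENNReal.ofReal (2 * (1 / L) + 1 / L))) := by
      gcongr
      · exact hι _ _
      · exact hι _ _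
      · exact hι _ _
      · exact hι _ _
    _ = ENNReal.ofReal (C * (C' + C' + Λ * ((2 * 1 + 1 / L) + (2 * 1 + 1 / L)) +
        (L * Λ) * ((2 * (1 / L) + 1 / L) + (2 * (1 / L) + 1 / L)))) := by
      have hΛ0 : 0 ≤ Λ := by linarith
      have h : ∀ p q : ℝ, 0 ≤ p → 0 ≤ q → ENNReal.ofReal C * (ENNReal.ofReal C' +
          ENNReal.ofReal C' + ENNReal.ofReal Λ * (ENNReal.ofReal p + ENNReal.ofReal p) +
          ENNReal.ofReal (L * Λ) * (ENNReal.ofReal q + ENNReal.ofReal q)) =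
          ENNReal.ofReal (C * (C' + C' + Λ * (p + p) + (L * Λ) * (q + q))) := by
        intro p q hp hq
        rw [ENNReal.ofReal_mul hC.le, ENNReal.ofReal_add (by positivity) (by positivity),
          ENNReal.ofReal_add (by positivity) (by positivity),
          ENNReal.ofReal_add hC'.le hC'.le, ENNReal.ofReal_mul hΛ0,
          ENNReal.ofReal_mul (by positivity : 0 ≤ L * Λ),
          ENNReal.ofReal_add hp hp, ENNReal.ofReal_add hq hq]
      exact h _ _ (by positivity) (by positivity)
    _ ≤ _ := by
      apply ENNReal.ofReal_le_ofReal
      rw [mul_assoc C]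
      refine mul_le_mul_of_nonneg_left ?_ hC.le
      have e : (L * Λ) * ((2 * (1 / L) + 1 / L) + (2 * (1 / L) + 1 / L)) = 6 * Λ := by
        field_simp
        ring
      rw [e]
      nlinarith

/-! ### The bilinear estimate on the Fourier side -/

lemma bracket_resonance_rpow_le (α x y τ σ : ℝ) :
    bracket (resonance α x y) ^ (1 / 2 : ℝ) ≤ bracket (τ - 1 * (x + y) ^ 3) ^ (1 / 2 : ℝ) +
      bracket (τ - σ - α * x ^ 3) ^ (1 / 2 : ℝ) + bracket (σ - α * y ^ 3) ^ (1 / 2 : ℝ) := by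
  have h0 := bracket_pos (τ - 1 * (x + y) ^ 3)
  have h1 := bracket_pos (τ - σ - α * x ^ 3)
  have h2 := bracket_pos (σ - α * y ^ 3)
  have h : bracket (resonance α x y) ≤ bracket (τ - 1 * (x + y) ^ 3) +
      bracket (τ - σ - α * x ^ 3) + bracket (σ - α * y ^ 3) := by
    -- The time frequencies cancel in the signed sum of the modulations.
    have e : resonance α x y =
        -(τ - 1 * (x + y) ^ 3) + (τ - σ - α * x ^ 3) + (σ - α * y ^ 3) := by
      unfold resonance
      ring
    have := abs_add_three (-(τ - 1 * (x + y) ^ 3)) (τ - σ - α * x ^ 3) (σ - α * y ^ 3)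
    rw [abs_neg] at this
    rw [e]
    unfold bracket
    linarith
  calc bracket (resonance α x y) ^ (1 / 2 : ℝ)
      ≤ (bracket (τ - 1 * (x + y) ^ 3) + bracket (τ - σ - α * x ^ 3) +
          bracket (σ - α * y ^ 3)) ^ (1 / 2 : ℝ) := by
        gcongr
        exact (bracket_pos _).le
    _ ≤ (bracket (τ - 1 * (x + y) ^ 3) + bracket (τ - σ - α * x ^ 3)) ^ (1 / 2 : ℝ) +
          bracket (σ - α * y ^ 3) ^ (1 / 2 : ℝ) :=
        Real.rpow_add_le_add_rpow (by positivity) h2.le (by norm_num) (by norm_num)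
    _ ≤ _ := by
        gcongr
        exact Real.rpow_add_le_add_rpow h0.le h1.le (by norm_num) (by norm_num)

lemma sqrt_kernelSq (α s x y : ℝ) :
    Real.sqrt (kernelSq α s x y) * (bracket x ^ s * bracket y ^ s *
      bracket (resonance α x y) ^ (1 / 2 : ℝ)) = |x + y| * bracket (x + y) ^ s := by
  have hx := bracket_pos x
  have hy := bracket_pos y
  have hz := bracket_pos (x + y)
  have hr := bracket_pos (resonance α x y)
  have e : ∀ {b : ℝ}, 0 < b → b ^ (2 * s) = (b ^ s) ^ 2 := fun hb => by
    rw [mul_comm, Real.rpow_mul hb.le, Real.rpow_two]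
  have e' : bracket (resonance α x y) = (bracket (resonance α x y) ^ (1 / 2 : ℝ)) ^ 2 := by
    rw [← Real.rpow_two, ← Real.rpow_mul hr.le]
    norm_num
  have : kernelSq α s x y = (|x + y| * bracket (x + y) ^ s / (bracket x ^ s * bracket y ^ s *
      bracket (resonance α x y) ^ (1 / 2 : ℝ))) ^ 2 := by
    unfold kernelSq
    rw [e hx, e hy, e hz]
    nth_rewrite 1 [e']
    rw [← sq_abs (x + y)]
    ring
  rw [this, Real.sqrt_sq (by positivity)]
  field_simp

/-- The trivial powers with exponent `0` are kept so that each factor is literally a value of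
`weighted`. -/
lemma multiplier_le (α s x y τ σ : ℝ) {p q : ℝ} (hp : 0 ≤ p) (hq : 0 ≤ q) :
    |x + y| * bracket (x + y) ^ s * (p * q) ≤ Real.sqrt (kernelSq α s x y) *
      (bracket (τ - 1 * (x + y) ^ 3) ^ (1 / 2 : ℝ) *
        ((bracket x ^ s * bracket (τ - σ - α * x ^ 3) ^ (0 : ℝ) * p) *
          (bracket y ^ s * bracket (σ - α * y ^ 3) ^ (0 : ℝ) * q)) +
        (bracket x ^ s * bracket (τ - σ - α * x ^ 3) ^ (1 / 2 : ℝ) * p) *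
          (bracket y ^ s * bracket (σ - α * y ^ 3) ^ (0 : ℝ) * q) +
        (bracket x ^ s * bracket (τ - σ - α * x ^ 3) ^ (0 : ℝ) * p) *
          (bracket y ^ s * bracket (σ - α * y ^ 3) ^ (1 / 2 : ℝ) * q)) := by
  have hx := bracket_pos x
  have hy := bracket_pos y
  simp only [Real.rpow_zero, mul_one]
  rw [← sqrt_kernelSq α s x y]
  have h := bracket_resonance_rpow_le α x y τ σ
  calc _ = Real.sqrt (kernelSq α s x y) * (bracket x ^ s * bracket y ^ s * (p * q)) *
        bracket (resonance α x y) ^ (1 / 2 : ℝ) := by ring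
    _ ≤ Real.sqrt (kernelSq α s x y) * (bracket x ^ s * bracket y ^ s * (p * q)) *
        (bracket (τ - 1 * (x + y) ^ 3) ^ (1 / 2 : ℝ) +
      bracket (τ - σ - α * x ^ 3) ^ (1 / 2 : ℝ) + bracket (σ - α * y ^ 3) ^ (1 / 2 : ℝ)) := by
      gcongr
    _ = _ := by ring

lemma measurable_weighted {L a s b : ℝ} {f : ℤ → ℝ → ℂ} {k : ℤ} (hf : Measurable (f k)) :
    Measurable (weighted L a s b f k) := by
  unfold weighted
  have : Measurable fun τ : ℝ => bracket (τ - a * (k / L) ^ 3) ^ b :=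
    (measurable_bracket.comp (measurable_id.sub_const _)).pow_const b
  fun_prop

lemma weighted_zero_le (L a s : ℝ) (f : ℤ → ℝ → ℂ) (k : ℤ) (τ : ℝ) :
    weighted L a s 0 f k τ ≤ weighted L a s (1 / 2) f k τ := by
  unfold weighted
  have := bracket_pos ((k : ℝ) / L)
  gcongr
  · exact one_le_bracket _
  · norm_num

lemma weighted_eq (L a s b : ℝ) (f : ℤ → ℝ → ℂ) (k : ℤ) (τ : ℝ) :
    weighted L a s b f k τ = ENNReal.ofReal (bracket (τ - a * (k / L) ^ 3) ^ b) *
      (ENNReal.ofReal (bracket (k / L) ^ s) * ‖f k τ‖ₑ) := by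
  have := bracket_pos ((k : ℝ) / L)
  have := bracket_pos (τ - a * (k / L) ^ 3)
  unfold weighted
  rw [mul_assoc, mul_left_comm, ENNReal.ofReal_mul (by positivity),
    ENNReal.ofReal_mul (by positivity), ofReal_norm]

lemma add_sq_le_four (x y : ℝ≥0∞) : (x + y) ^ 2 ≤ 4 * (x ^ 2 + y ^ 2) := by
  wlog h : x ≤ y generalizing x y
  · rw [add_comm x y, add_comm (x ^ 2)]
    exact this y x (le_of_not_ge h)
  calc (x + y) ^ 2 ≤ (y + y) ^ 2 := by gcongr
    _ = 4 * y ^ 2 := by ring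
    _ ≤ _ := by gcongr; exact le_add_self

/-- The squared norm `‖⟨τ⟩⁻¹‖²` in `L²(ℝ)`. -/
def bracketInvSq : ℝ≥0∞ := ∫⁻ τ : ℝ, ENNReal.ofReal (bracket τ ^ (-1 : ℝ)) ^ 2

lemma bracketInvSq_lt_top : bracketInvSq < ⊤ := by
  have h : ∫⁻ x : ℝ, ENNReal.ofReal ((1 + ‖x‖) ^ (-(2 : ℝ))) < ⊤ :=
    finite_integral_one_add_norm (by simp)
  refine lt_of_le_of_lt (lintegral_mono fun τ => le_of_eq ?_) h
  have := bracket_pos τ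
  rw [← ENNReal.ofReal_pow (by positivity), ← Real.rpow_two, ← Real.rpow_mul this.le]
  norm_num [bracket]

/-- The constant lost in passing from the trilinear kernel bound to the norms. -/
def convConst : ℝ≥0∞ := (4 * (4 + 1 + 4)) ^ (1 / 2 : ℝ) + (4 * (1 + bracketInvSq * 8)) ^ (1 / 2 : ℝ)

lemma convConst_lt_top : convConst < ⊤ := by
  have := bracketInvSq_lt_top
  unfold convConst
  refine ENNReal.add_lt_top.2 ⟨ENNReal.rpow_lt_top_of_nonneg (by norm_num) (by norm_num),
    ENNReal.rpow_lt_top_of_nonneg (by norm_num) ?_⟩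
  finiteness

/-- The resonance inequality splits `F` into three pieces, according to whether the output or one of
the inputs carries the modulation. The `L²_ξ L¹_τ` parts of the norms supply the `L¹` factor in
Young's inequality. -/
theorem norm_conv_le {L α s : ℝ} {D : ℝ≥0∞} {f₁ f₂ F : ℤ → ℝ → ℂ}
    (hD : ∀ k : ℤ, ∑' j : ℤ, ENNReal.ofReal (2 * Real.pi * L)⁻¹ *
      ENNReal.ofReal (kernelSq α s (((k - j : ℤ) : ℝ) / L) ((j : ℝ) / L)) ≤ D)
    (h₁ : ∀ k, Measurable (f₁ k)) (h₂ : ∀ k, Measurable (f₂ k))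
    (hF : ∀ k τ, ‖F k τ‖ₑ ≤ ENNReal.ofReal |(k : ℝ) / L| *
      ∑' j, ENNReal.ofReal (2 * Real.pi * L)⁻¹ *
        lconv (fun σ => ‖f₁ (k - j) σ‖ₑ) (fun σ => ‖f₂ j σ‖ₑ) τ) :
    normL2L2 L 1 s (-1 / 2) F + normL2L1 L 1 s (-1) F ≤ convConst * D ^ (1 / 2 : ℝ) *
      (normL2L2 L α s (1 / 2) f₁ + normL2L1 L α s 0 f₁) *
      (normL2L2 L α s (1 / 2) f₂ + normL2L1 L α s 0 f₂) := by
  set ω := ENNReal.ofReal (2 * Real.pi * L)⁻¹ with hω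
  let G₁ := weighted L α s (1 / 2) f₁
  let G₂ := weighted L α s (1 / 2) f₂
  let H₁ := weighted L α s 0 f₁
  let H₂ := weighted L α s 0 f₂
  have mG₁ : ∀ k, Measurable (G₁ k) := fun k => measurable_weighted (h₁ k)
  have mG₂ : ∀ k, Measurable (G₂ k) := fun k => measurable_weighted (h₂ k)
  have mH₁ : ∀ k, Measurable (H₁ k) := fun k => measurable_weighted (h₁ k)
  have mH₂ : ∀ k, Measurable (H₂ k) := fun k => measurable_weighted (h₂ k)
  let w : ℤ → ℤ → ℝ≥0∞ := fun k j =>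
    ENNReal.ofReal (Real.sqrt (kernelSq α s (((k - j : ℤ) : ℝ) / L) ((j : ℝ) / L)))
  have hw : ∀ k, ∑' j, ω * w k j ^ 2 ≤ D := by
    intro k
    refine le_trans (le_of_eq ?_) (hD k)
    congr! 3 with j
    rw [← ENNReal.ofReal_pow (Real.sqrt_nonneg _), Real.sq_sqrt (kernelSq_nonneg _ _ _ _)]
  set N₁ := normL2L2 L α s (1 / 2) f₁ + normL2L1 L α s 0 f₁ with hN₁
  set N₂ := normL2L2 L α s (1 / 2) f₂ + normL2L1 L α s 0 f₂ with hN₂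
  have hroot : ∀ {x y : ℝ≥0∞}, x ^ (1 / 2 : ℝ) ≤ y → x ≤ y ^ 2 := fun {x y} h => by
    calc x = (x ^ (1 / 2 : ℝ)) ^ (2 : ℝ) := by rw [← ENNReal.rpow_mul]; norm_num
      _ ≤ y ^ (2 : ℝ) := by gcongr
      _ = y ^ 2 := ENNReal.rpow_two y
  have a₁ : ∑' k, ω * ∫⁻ τ, G₁ k τ ^ 2 ≤ N₁ ^ 2 := hroot (le_self_add (b := normL2L1 L α s 0 f₁))
  have a₂ : ∑' k, ω * ∫⁻ τ, G₂ k τ ^ 2 ≤ N₂ ^ 2 := hroot (le_self_add (b := normL2L1 L α s 0 f₂))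
  have b₁ : ∑' k, ω * (∫⁻ τ, H₁ k τ) ^ 2 ≤ N₁ ^ 2 :=
    hroot (le_add_self (a := normL2L1 L α s 0 f₁))
  have b₂ : ∑' k, ω * (∫⁻ τ, H₂ k τ) ^ 2 ≤ N₂ ^ 2 :=
    hroot (le_add_self (a := normL2L1 L α s 0 f₂))
  have a₁' : ∑' k, ω * ∫⁻ τ, H₁ k τ ^ 2 ≤ N₁ ^ 2 := by
    refine le_trans ?_ a₁
    gcongr
    exact weighted_zero_le _ _ _ _ _ _
  set Y := D * (N₁ ^ 2 * N₂ ^ 2) with hY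
  -- In `P` the first input carries the modulation weight, in `Q` the second. `R` has no input
  -- modulation weight; the output modulation stands in front of it in `key`.
  let P : ℤ → ℝ → ℝ≥0∞ := fun k τ => ∑' j, ω * (w k j * lconv (G₁ (k - j)) (H₂ j) τ)
  let Q : ℤ → ℝ → ℝ≥0∞ := fun k τ => ∑' j, ω * (w k j * lconv (H₁ (k - j)) (G₂ j) τ)
  let R : ℤ → ℝ → ℝ≥0∞ := fun k τ => ∑' j, ω * (w k j * lconv (H₁ (k - j)) (H₂ j) τ)
  have mP : ∀ k, Measurable (P k) := fun k => Measurable.tsum fun j =>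
    ((measurable_lconv (mG₁ _) (mH₂ _)).const_mul _).const_mul _
  have mQ : ∀ k, Measurable (Q k) := fun k => Measurable.tsum fun j =>
    ((measurable_lconv (mH₁ _) (mG₂ _)).const_mul _).const_mul _
  have mR : ∀ k, Measurable (R k) := fun k => Measurable.tsum fun j =>
    ((measurable_lconv (mH₁ _) (mH₂ _)).const_mul _).const_mul _
  have hP : ∑' k, ω * ∫⁻ τ, P k τ ^ 2 ≤ Y := by
    refine (tsum_lintegral_sq_le (a := fun k => ∫⁻ τ, G₁ k τ ^ 2)
      (b := fun k => (∫⁻ τ, H₂ k τ) ^ 2) hw (fun k j => measurable_lconv (mG₁ _) (mH₂ _))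
      fun k j => lintegral_lconv_sq_le (mG₁ _) (mH₂ _)).trans ?_
    rw [hY]
    gcongr
  have hQ : ∑' k, ω * ∫⁻ τ, Q k τ ^ 2 ≤ Y := by
    refine (tsum_lintegral_sq_le (a := fun k => (∫⁻ τ, H₁ k τ) ^ 2)
      (b := fun k => ∫⁻ τ, G₂ k τ ^ 2) hw (fun k j => measurable_lconv (mH₁ _) (mG₂ _))
      fun k j => ?_).trans ?_
    · simp_rw [lconv_comm (H₁ (k - j))]
      rw [mul_comm]
      exact lintegral_lconv_sq_le (mG₂ _) (mH₁ _)
    · rw [hY]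
      gcongr
  have hR : ∑' k, ω * ∫⁻ τ, R k τ ^ 2 ≤ Y := by
    refine (tsum_lintegral_sq_le (a := fun k => ∫⁻ τ, H₁ k τ ^ 2)
      (b := fun k => (∫⁻ τ, H₂ k τ) ^ 2) hw (fun k j => measurable_lconv (mH₁ _) (mH₂ _))
      fun k j => lintegral_lconv_sq_le (mH₁ _) (mH₂ _)).trans ?_
    rw [hY]
    gcongr
  have hR1 : ∑' k, ω * (∫⁻ τ, R k τ) ^ 2 ≤ Y := by
    refine (tsum_sq_lintegral_le (a := fun k => (∫⁻ τ, H₁ k τ) ^ 2)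
      (b := fun k => (∫⁻ τ, H₂ k τ) ^ 2) hw (fun k j => measurable_lconv (mH₁ _) (mH₂ _))
      fun k j => ?_).trans ?_
    · rw [lintegral_lconv (mH₁ _) (mH₂ _), mul_pow]
    · rw [hY]
      gcongr
  have key : ∀ (k : ℤ) (τ : ℝ), ENNReal.ofReal (bracket (k / L) ^ s) * ‖F k τ‖ₑ ≤
      ENNReal.ofReal (bracket (τ - 1 * (k / L) ^ 3) ^ (1 / 2 : ℝ)) * R k τ + P k τ + Q k τ := by
    intro k τ
    set t := ENNReal.ofReal (bracket (τ - 1 * (k / L) ^ 3) ^ (1 / 2 : ℝ)) with ht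
    set e := ENNReal.ofReal (bracket (k / L) ^ s)
    calc e * ‖F k τ‖ₑ ≤ e * (ENNReal.ofReal |(k : ℝ) / L| *
          ∑' j, ω * lconv (fun σ => ‖f₁ (k - j) σ‖ₑ) (fun σ => ‖f₂ j σ‖ₑ) τ) := by
          gcongr
          exact hF k τ
      _ = ∑' j, ω * ((ENNReal.ofReal |(k : ℝ) / L| * e) *
          lconv (fun σ => ‖f₁ (k - j) σ‖ₑ) (fun σ => ‖f₂ j σ‖ₑ) τ) := by
        rw [← mul_assoc, ← ENNReal.tsum_mul_left]
        congr! 2 with j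
        ring
      _ ≤ ∑' j, ω * (w k j * (t * lconv (H₁ (k - j)) (H₂ j) τ +
          lconv (G₁ (k - j)) (H₂ j) τ + lconv (H₁ (k - j)) (G₂ j) τ)) := by
        refine ENNReal.tsum_le_tsum fun j => mul_le_mul_right ?_ _
        have m₁ := mG₁ (k - j)
        have m₂ := mG₂ j
        have m₃ := mH₁ (k - j)
        have m₄ := mH₂ j
        have m₅ := h₁ (k - j)
        have m₆ := h₂ j
        unfold lconv
        rw [← lintegral_const_mul _ (by fun_prop), ← lintegral_const_mul _ (by fun_prop),
          ← lintegral_add_left (by fun_prop), ← lintegral_add_left (by fun_prop),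
          ← lintegral_const_mul _ (by fun_prop)]
        refine lintegral_mono fun σ => ?_
        have hsum : (((k - j : ℤ) : ℝ) / L) + (j : ℝ) / L = k / L := by
          push_cast
          ring
        have h := multiplier_le α s (((k - j : ℤ) : ℝ) / L) ((j : ℝ) / L) τ σ
          (norm_nonneg (f₁ (k - j) (τ - σ))) (norm_nonneg (f₂ j σ))
        rw [hsum] at h
        have h' := ENNReal.ofReal_le_ofReal h
        have p0 := bracket_pos ((k : ℝ) / L)
        have p1 := bracket_pos (((k - j : ℤ) : ℝ) / L)
        have p2 := bracket_pos ((j : ℝ) / L)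
        have p3 := bracket_pos (τ - 1 * ((k : ℝ) / L) ^ 3)
        have p4 := bracket_pos (τ - σ - α * (((k - j : ℤ) : ℝ) / L) ^ 3)
        have p5 := bracket_pos (σ - α * ((j : ℝ) / L) ^ 3)
        rw [ENNReal.ofReal_mul (by positivity), ENNReal.ofReal_mul (abs_nonneg _),
          ENNReal.ofReal_mul (norm_nonneg _), ofReal_norm, ofReal_norm,
          ENNReal.ofReal_mul (Real.sqrt_nonneg _), ENNReal.ofReal_add (by positivity)
          (by positivity), ENNReal.ofReal_add (by positivity) (by positivity)] at h'
        refine h'.trans (le_of_eq ?_)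
        congr 1
        congr 1
        · congr 1
          · rw [ENNReal.ofReal_mul (by positivity), ENNReal.ofReal_mul (by positivity)]
            rfl
          · rw [ENNReal.ofReal_mul (by positivity)]
            rfl
        · rw [ENNReal.ofReal_mul (by positivity)]
          rfl
      _ = t * R k τ + P k τ + Q k τ := by
        rw [← ENNReal.tsum_mul_left, ← ENNReal.tsum_add, ← ENNReal.tsum_add]
        congr! 2 with j
        ring
  have hb : ∀ x, 0 < bracket x := bracket_pos
  have bd2 : ∀ k τ, weighted L 1 s (-1 / 2) F k τ ≤ (R k τ + P k τ) + Q k τ := by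
    intro k τ
    rw [weighted_eq]
    refine (mul_le_mul_right (key k τ) _).trans ?_
    have e1 : ENNReal.ofReal (bracket (τ - 1 * (k / L) ^ 3) ^ (-1 / 2 : ℝ)) ≤ 1 := by
      rw [ENNReal.ofReal_le_one]
      exact Real.rpow_le_one_of_one_le_of_nonpos (one_le_bracket _) (by norm_num)
    have e2 : ENNReal.ofReal (bracket (τ - 1 * (k / L) ^ 3) ^ (-1 / 2 : ℝ)) *
        ENNReal.ofReal (bracket (τ - 1 * (k / L) ^ 3) ^ (1 / 2 : ℝ)) = 1 := by
      rw [← ENNReal.ofReal_mul (Real.rpow_nonneg (hb _).le _), ← Real.rpow_add (hb _)]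
      norm_num
    rw [mul_add, mul_add, ← mul_assoc, e2, one_mul]
    gcongr
    · exact mul_le_of_le_one_left' e1
    · exact mul_le_of_le_one_left' e1
  -- The weight `⟨τ - ξ³⟩⁻¹` cancels the half power in front of `R`, which is handled in `L¹`. For
  -- `P` and `Q`, known only in `L²`, it is kept whole and is square integrable in `τ`.
  have bd1 : ∀ k τ, weighted L 1 s (-1) F k τ ≤ R k τ +
      ENNReal.ofReal (bracket (τ - 1 * (k / L) ^ 3) ^ (-1 : ℝ)) * (P k τ + Q k τ) := by
    intro k τ
    rw [weighted_eq]
    refine (mul_le_mul_right (key k τ) _).trans ?_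
    have e2 : ENNReal.ofReal (bracket (τ - 1 * (k / L) ^ 3) ^ (-1 : ℝ)) *
        ENNReal.ofReal (bracket (τ - 1 * (k / L) ^ 3) ^ (1 / 2 : ℝ)) ≤ 1 := by
      rw [← ENNReal.ofReal_mul (Real.rpow_nonneg (hb _).le _), ← Real.rpow_add (hb _),
        ENNReal.ofReal_le_one]
      exact Real.rpow_le_one_of_one_le_of_nonpos (one_le_bracket _) (by norm_num)
    rw [add_assoc, mul_add, ← mul_assoc]
    gcongr
    exact mul_le_of_le_one_left' e2
  have s2 : ∑' k, ω * ∫⁻ τ, weighted L 1 s (-1 / 2) F k τ ^ 2 ≤ (4 * (4 + 1 + 4)) * Y := by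
    calc ∑' k, ω * ∫⁻ τ, weighted L 1 s (-1 / 2) F k τ ^ 2
        ≤ ∑' k, ω * ∫⁻ τ, 4 * (4 * (R k τ ^ 2 + P k τ ^ 2) + Q k τ ^ 2) := by
          gcongr with k τ
          refine (pow_le_pow_left' (bd2 k τ) 2).trans ((add_sq_le_four _ _).trans ?_)
          gcongr
          exact add_sq_le_four _ _
      _ = 4 * (4 * ((∑' k, ω * ∫⁻ τ, R k τ ^ 2) + (∑' k, ω * ∫⁻ τ, P k τ ^ 2)) +
            (∑' k, ω * ∫⁻ τ, Q k τ ^ 2)) := by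
        rw [← ENNReal.tsum_add, ← ENNReal.tsum_mul_left, ← ENNReal.tsum_add,
          ← ENNReal.tsum_mul_left]
        congr! 2 with k
        have := mP k
        have := mQ k
        have := mR k
        rw [lintegral_const_mul _ (by fun_prop), lintegral_add_left (by fun_prop),
          lintegral_const_mul _ (by fun_prop), lintegral_add_left (by fun_prop)]
        ring
      _ ≤ 4 * (4 * (Y + Y) + Y) := by gcongr
      _ = _ := by ring
  have s1 : ∑' k, ω * (∫⁻ τ, weighted L 1 s (-1) F k τ) ^ 2 ≤
      (4 * (1 + bracketInvSq * 8)) * Y := by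
    calc ∑' k, ω * (∫⁻ τ, weighted L 1 s (-1) F k τ) ^ 2
        ≤ ∑' k, ω * (4 * ((∫⁻ τ, R k τ) ^ 2 +
            bracketInvSq * (4 * ((∫⁻ τ, P k τ ^ 2) + ∫⁻ τ, Q k τ ^ 2)))) := by
          gcongr with k
          have := mP k
          have := mQ k
          have := mR k
          have mb : Measurable fun τ : ℝ =>
              ENNReal.ofReal (bracket (τ - 1 * (k / L) ^ 3) ^ (-1 : ℝ)) :=
            ((measurable_bracket.comp (measurable_id.sub_const _)).pow_const _).ennreal_ofReal
          refine (pow_le_pow_left' (lintegral_mono (bd1 k)) 2).trans ?_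
          rw [lintegral_add_left (by fun_prop)]
          refine (add_sq_le_four _ _).trans ?_
          gcongr
          refine (lintegral_mul_sq_le volume mb.aemeasurable (by fun_prop)).trans ?_
          rw [lintegral_sub_right_eq_self
            (fun τ => ENNReal.ofReal (bracket τ ^ (-1 : ℝ)) ^ 2) (1 * ((k : ℝ) / L) ^ 3)]
          unfold bracketInvSq
          gcongr
          rw [← lintegral_add_left (by fun_prop), ← lintegral_const_mul _ (by fun_prop)]
          exact lintegral_mono fun τ => add_sq_le_four _ _
      _ = 4 * ((∑' k, ω * (∫⁻ τ, R k τ) ^ 2) + bracketInvSq *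
            (4 * ((∑' k, ω * ∫⁻ τ, P k τ ^ 2) + (∑' k, ω * ∫⁻ τ, Q k τ ^ 2)))) := by
        rw [← ENNReal.tsum_add, ← ENNReal.tsum_mul_left, ← ENNReal.tsum_mul_left,
          ← ENNReal.tsum_add, ← ENNReal.tsum_mul_left]
        congr! 2 with k
        ring
      _ ≤ 4 * (Y + bracketInvSq * (4 * (Y + Y))) := by gcongr
      _ = _ := by ring
  have hYroot : Y ^ (1 / 2 : ℝ) = D ^ (1 / 2 : ℝ) * (N₁ * N₂) := by
    rw [hY, ← mul_pow, ENNReal.mul_rpow_of_nonneg _ _ (by norm_num), ← ENNReal.rpow_two,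
      ← ENNReal.rpow_mul]
    norm_num
  calc normL2L2 L 1 s (-1 / 2) F + normL2L1 L 1 s (-1) F
      ≤ ((4 * (4 + 1 + 4)) * Y) ^ (1 / 2 : ℝ) +
        ((4 * (1 + bracketInvSq * 8)) * Y) ^ (1 / 2 : ℝ) := by
        unfold normL2L2 normL2L1
        gcongr
    _ = convConst * D ^ (1 / 2 : ℝ) * N₁ * N₂ := by
      rw [ENNReal.mul_rpow_of_nonneg (4 * (4 + 1 + 4)) Y (by norm_num),
        ENNReal.mul_rpow_of_nonneg (4 * (1 + bracketInvSq * 8)) Y (by norm_num), hYroot]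
      unfold convConst
      ring

/-! ### Characters and Schwartz functions -/

/-- The character `θ ↦ e^{iθ}`. -/
def chr (θ : ℝ) : ℂ := Complex.exp (Complex.I * (θ : ℂ))

lemma norm_chr (θ : ℝ) : ‖chr θ‖ = 1 := by
  rw [chr, mul_comm, Complex.norm_exp_ofReal_mul_I]

@[fun_prop]
lemma continuous_chr : Continuous chr := by
  unfold chr
  fun_prop

lemma chr_add (x y : ℝ) : chr (x + y) = chr x * chr y := by
  unfold chr
  rw [← Complex.exp_add]
  push_cast
  ring_nf

lemma exp_neg_I_mul (θ : ℝ) : Complex.exp (-Complex.I * (θ : ℂ)) = chr (-θ) := by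
  unfold chr
  push_cast
  ring_nf

/-- Dilation of a Schwartz function. -/
def dilate (a : ℝ) (ha : a ≠ 0) (ψ : 𝓢(ℝ, ℂ)) : 𝓢(ℝ, ℂ) :=
  SchwartzMap.compCLMOfContinuousLinearEquiv ℂ
    (ContinuousLinearEquiv.unitsEquivAut ℝ (Units.mk0 a ha)) ψ

lemma dilate_apply (a : ℝ) (ha : a ≠ 0) (ψ : 𝓢(ℝ, ℂ)) (t : ℝ) : dilate a ha ψ t = ψ (t * a) := by
  simp [dilate]

/-- The Fourier transform `t ↦ ∫ e^{-itτ} ψ(τ) dτ` of a Schwartz function. -/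
def schwartzHat (ψ : 𝓢(ℝ, ℂ)) : 𝓢(ℝ, ℂ) :=
  dilate (2 * Real.pi)⁻¹ (by positivity) (FourierTransform.fourier ψ)

lemma schwartzHat_apply (ψ : 𝓢(ℝ, ℂ)) (t : ℝ) :
    schwartzHat ψ t = ∫ τ : ℝ, chr (-(t * τ)) * ψ τ := by
  rw [schwartzHat, dilate_apply, SchwartzMap.fourier_coe, Real.fourier_eq']
  refine integral_congr_ae (.of_forall fun τ => ?_)
  simp only [smul_eq_mul, chr]
  congr 2
  rw [mul_comm]
  congr 2
  simp
  field_simp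

/-- Every Schwartz function of time occurs in the pairing that defines `HasFourier`; the explicit
preimage makes the right side of that pairing computable by Fubini. -/
lemma exists_schwartzHat_eq (η : 𝓢(ℝ, ℂ)) :
    ∃ ψ : 𝓢(ℝ, ℂ), schwartzHat ψ = η ∧
      ∀ τ, ψ τ = (2 * Real.pi : ℂ)⁻¹ * ∫ t : ℝ, chr (t * τ) * η t := by
  have h2 : (2 * Real.pi : ℝ) ≠ 0 := by positivity
  refine ⟨FourierTransformInv.fourierInv (dilate (2 * Real.pi) h2 η), ?_, fun τ => ?_⟩
  · ext t
    rw [schwartzHat, FourierTransform.fourier_fourierInv_eq, dilate_apply, dilate_apply]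
    congr 1
    field_simp
  · rw [SchwartzMap.fourierInv_coe, Real.fourierInv_eq']
    have h := Measure.integral_comp_mul_right (fun t : ℝ => chr (t * τ) * η t) (2 * Real.pi)
    rw [abs_of_pos (by positivity)] at h
    have e : (2 * Real.pi : ℂ)⁻¹ * ∫ t : ℝ, chr (t * τ) * η t =
        (2 * Real.pi)⁻¹ • ∫ t : ℝ, chr (t * τ) * η t := by
      rw [Complex.real_smul]
      push_cast
      rfl
    rw [e, ← h]
    refine integral_congr_ae (.of_forall fun t => ?_)
    simp only [smul_eq_mul, chr, dilate_apply]
    congr 2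
    rw [mul_comm]
    congr 2
    simp
    ring

lemma fourierTest_apply (L : ℝ) (k : ℤ) (ψ : 𝓢(ℝ, ℂ)) (p : ℝ × ℝ) :
    fourierTest L k ψ p = chr (-(p.1 * (k / L))) * schwartzHat ψ p.2 := by
  rw [fourierTest, schwartzHat_apply, exp_neg_I_mul]
  simp_rw [exp_neg_I_mul]

/-- Translating a Schwartz function modulates its Fourier transform. -/
lemma schwartzHat_translate (ψ : 𝓢(ℝ, ℂ)) (σ t : ℝ) :
    schwartzHat (SchwartzMap.compSubConstCLM ℂ (-σ) ψ) t = chr (t * σ) * schwartzHat ψ t := by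
  rw [schwartzHat_apply, schwartzHat_apply, ← integral_const_mul,
    ← integral_sub_right_eq_self _ σ]
  refine integral_congr_ae (.of_forall fun τ => ?_)
  simp only [SchwartzMap.compSubConstCLM_apply]
  rw [← mul_assoc, ← chr_add]
  congr 2
  · ring
  · ring

/-! ### Fourier series on a period -/

/-- Summable coefficients make the series converge uniformly to a continuous function. The series
also converges to `g` in `L²`, so the two limits agree almost everywhere. -/
lemma ae_eq_tsum_chr {L : ℝ} (hL : 0 < L) {g : ℝ → ℂ}
    (hg : MemLp g 2 (volume.restrict (Set.Ioc 0 (2 * Real.pi * L)))) {c : ℤ → ℂ}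
    (hc : ∀ k : ℤ, ∫ x in Set.Ioc 0 (2 * Real.pi * L), g x * chr (-(x * (k / L))) =
      2 * Real.pi * L * c k)
    (hs : Summable fun k => ‖c k‖) :
    ∀ᵐ x ∂volume.restrict (Set.Ioc 0 (2 * Real.pi * L)),
      g x = ∑' k : ℤ, c k * chr (x * (k / L)) := by
  set T := 2 * Real.pi * L with hT
  have hT0 : 0 < T := by positivity
  have : Fact (0 < T) := ⟨hT0⟩
  have hfc : ∀ (n : ℤ) (x : ℝ), fourier n (x : AddCircle T) = chr (x * (n / L)) := by
    intro n x
    rw [fourier_coe_apply, chr]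
    congr 1
    rw [hT]
    have : (L : ℂ) ≠ 0 := by exact_mod_cast hL.ne'
    have : (Real.pi : ℂ) ≠ 0 := by exact_mod_cast Real.pi_ne_zero
    push_cast
    field_simp
  have hg0 : MemLp g 2 (volume.restrict (Set.Ioc 0 (0 + T))) := by rwa [zero_add]
  have hF := hg0.memLp_liftIoc.haarAddCircle
  set F := AddCircle.liftIoc T 0 g with hFdef
  have hcoef : ∀ k, fourierCoeff F k = c k := by
    intro k
    rw [fourierCoeff_eq_intervalIntegral F k 0, zero_add,
      intervalIntegral.integral_of_le hT0.le]
    have : ∫ x in Set.Ioc 0 T, fourier (-k) (x : AddCircle T) • F x =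
        ∫ x in Set.Ioc 0 T, g x * chr (-(x * (k / L))) := by
      refine setIntegral_congr_fun measurableSet_Ioc fun x hx => ?_
      simp only [hfc, smul_eq_mul]
      rw [hFdef, AddCircle.liftIoc_zero_coe_apply hx, mul_comm]
      congr 2
      push_cast
      ring
    rw [this, hc k, Complex.real_smul]
    have : (T : ℂ) ≠ 0 := by exact_mod_cast hT0.ne'
    have e : (2 * Real.pi * L : ℂ) = (T : ℂ) := by rw [hT]; push_cast; ring
    rw [e]
    push_cast
    field_simp
  have hsum : Summable fun k => c k • (fourier k : C(AddCircle T, ℂ)) := by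
    refine Summable.of_norm ?_
    simpa [norm_smul, fourier_norm] using hs
  set S : C(AddCircle T, ℂ) := ∑' k, c k • (fourier k : C(AddCircle T, ℂ)) with hS
  have h1 : HasSum (fun k => c k • fourierLp 2 k)
      (ContinuousMap.toLp (E := ℂ) 2 AddCircle.haarAddCircle ℂ S) := by
    have := (ContinuousMap.toLp (E := ℂ) 2 (AddCircle.haarAddCircle (T := T)) ℂ).hasSum hsum.hasSum
    simpa only [map_smul] using this
  have h2 : HasSum (fun k => c k • fourierLp 2 k) hF.toLp := by
    have := hasSum_fourier_series_L2 hF.toLp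
    simpa only [fourierCoeff_congr_ae hF.coeFn_toLp, hcoef] using this
  have h3 : (hF.toLp : AddCircle T → ℂ) =ᵐ[AddCircle.haarAddCircle] S := by
    rw [h2.unique h1]
    exact ContinuousMap.coeFn_toLp _ _
  have h4 : ∀ᵐ y ∂(volume : Measure (AddCircle T)), F y = S y := by
    rw [AddCircle.volume_eq_smul_haarAddCircle]
    refine Measure.ae_smul_measure ?_ _
    filter_upwards [h3, hF.coeFn_toLp] with y hy hy'
    rw [← hy', hy]
  have h5 := (AddCircle.measurePreserving_mk T 0).quasiMeasurePreserving.ae h4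
  rw [zero_add] at h5
  filter_upwards [h5, ae_restrict_mem measurableSet_Ioc] with x hx hxm
  have : F (x : AddCircle T) = g x := AddCircle.liftIoc_zero_coe_apply hxm
  rw [← this]
  refine hx.trans ?_
  have h6 := (ContinuousMap.hasSum_apply hsum.hasSum (x : AddCircle T)).tsum_eq
  rw [hS, ← h6]
  simp [hfc]

/-! ### Fourier inversion on `𝕋_L × ℝ` -/

/-- Lebesgue measure on one spatial period. -/
abbrev periodMeasure (L : ℝ) : Measure ℝ := volume.restrict (Set.Ioc 0 (2 * Real.pi * L))

/-- The product of the counting measure on `ℤ` and Lebesgue measure on `ℝ`. -/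
abbrev freqMeasure : Measure (ℤ × ℝ) := Measure.count.prod volume

lemma restrict_strip (L : ℝ) :
    (volume : Measure (ℝ × ℝ)).restrict (strip L) = (periodMeasure L).prod volume := by
  rw [strip, Measure.volume_eq_prod, ← Measure.prod_restrict, Measure.restrict_univ]

lemma integrable_mul_chr {X : Type*} [MeasurableSpace X] {μ : Measure X} {F : X → ℂ}
    (hF : Integrable F μ) {φ : X → ℝ} (hφ : Measurable φ) :
    Integrable (fun x => F x * chr (φ x)) μ := by
  refine hF.mono (hF.1.mul (continuous_chr.measurable.comp hφ).aestronglyMeasurable)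
    (.of_forall fun x => ?_)
  rw [norm_mul, norm_chr, mul_one]

lemma memLp_schwartzHat (L : ℝ) (ψ : 𝓢(ℝ, ℂ)) :
    MemLp (fun p : ℝ × ℝ => schwartzHat ψ p.2) 2 ((periodMeasure L).prod volume) :=
  ((schwartzHat ψ).memLp 2 volume).comp_snd _

lemma integrable_mul_fourierTest {L : ℝ} {v : ℝ × ℝ → ℂ}
    (hv : MemLp v 2 ((periodMeasure L).prod volume)) (k : ℤ) (ψ : 𝓢(ℝ, ℂ)) :
    Integrable (fun p => v p * fourierTest L k ψ p) ((periodMeasure L).prod volume) := by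
  have h := integrable_mul_chr (hv.integrable_mul (memLp_schwartzHat L ψ))
    (φ := fun p => -(p.1 * (k / L))) (by fun_prop)
  refine h.congr (.of_forall fun p => ?_)
  simp only [Pi.mul_apply, fourierTest_apply]
  ring

/-- Both sides are locally integrable in `t`, so it suffices to test against smooth compactly
supported `g`. Such a `g` is the transform of a Schwartz function, and the identity becomes the one
defining `HasFourier`. -/
lemma ae_integral_slice_eq {L : ℝ} {v : ℝ × ℝ → ℂ}
    (hv : MemLp v 2 ((periodMeasure L).prod volume)) {f : ℤ → ℝ → ℂ}
    (hf : HasFourier L (ofFun L v) f) (k : ℤ) (hi : Integrable (f k)) :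
    ∀ᵐ t : ℝ, ∫ x, v (x, t) * chr (-(x * (k / L))) ∂(periodMeasure L) =
      (2 * Real.pi : ℂ)⁻¹ * ∫ τ : ℝ, f k τ * chr (t * τ) := by
  refine ae_eq_of_integral_contDiff_smul_eq ?_ ?_ fun g hg hgs => ?_
  · rw [locallyIntegrable_iff]
    intro K hK
    have : IsFiniteMeasure (volume.restrict K) := ⟨by simpa using hK.measure_lt_top⟩
    have h1 : MemLp v 2 ((periodMeasure L).prod (volume.restrict K)) :=
      hv.mono_measure (Measure.prod_mono le_rfl Measure.restrict_le_self)
    have h2 := integrable_mul_chr (h1.integrable one_le_two)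
      (φ := fun p => -(p.1 * (k / L))) (by fun_prop)
    exact h2.integral_prod_right
  · refine Continuous.locallyIntegrable (continuous_const.mul ?_)
    refine continuous_of_dominated (bound := fun τ => ‖f k τ‖) (fun t => ?_) (fun t => ?_) hi.norm
      (.of_forall fun τ => by fun_prop)
    · exact (integrable_mul_chr hi (φ := fun τ => t * τ) (by fun_prop)).1
    · exact .of_forall fun τ => by rw [norm_mul, norm_chr, mul_one]
  · have hgs' : HasCompactSupport fun t => (g t : ℂ) := hgs.comp_left (g := fun x : ℝ => (x : ℂ)) rfl
    have hg' : ContDiff ℝ (⊤ : ℕ∞) fun t => (g t : ℂ) := Complex.ofRealCLM.contDiff.comp hg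
    set η := hgs'.toSchwartzMap hg' with hη
    have hηg : ∀ t, η t = (g t : ℂ) := fun t => rfl
    obtain ⟨ψ, hψ, hψ'⟩ := exists_schwartzHat_eq η
    have h := ((hf k).2 ψ).2
    have h1 : ofFun L v (fourierTest L k ψ) =
        ∫ t, g t • ∫ x, v (x, t) * chr (-(x * (k / L))) ∂(periodMeasure L) := by
      rw [ofFun, restrict_strip, integral_prod_symm _ (integrable_mul_fourierTest hv k ψ)]
      refine integral_congr_ae (.of_forall fun t => ?_)
      simp only
      rw [Complex.real_smul, ← integral_const_mul]
      refine integral_congr_ae (.of_forall fun x => ?_)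
      simp only [fourierTest_apply, hψ, hηg]
      ring
    rw [← h1, h]
    have hsw : Integrable (Function.uncurry fun τ t : ℝ => f k τ * η t * chr (t * τ))
        (volume.prod volume) :=
      integrable_mul_chr (hi.mul_prod η.integrable) (φ := fun p => p.2 * p.1) (by fun_prop)
    calc ∫ τ, f k τ * ψ τ
        = ∫ τ, (2 * Real.pi : ℂ)⁻¹ * ∫ t, f k τ * η t * chr (t * τ) := by
          refine integral_congr_ae (.of_forall fun τ => ?_)
          simp only
          rw [hψ', mul_left_comm, ← integral_const_mul]
          congr 1
          refine integral_congr_ae (.of_forall fun t => ?_)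
          ring
      _ = (2 * Real.pi : ℂ)⁻¹ * ∫ t, ∫ τ, f k τ * η t * chr (t * τ) := by
        rw [integral_const_mul, integral_integral_swap hsw]
      _ = ∫ t, g t • ((2 * Real.pi : ℂ)⁻¹ * ∫ τ, f k τ * chr (t * τ)) := by
        rw [← integral_const_mul]
        congr 1
        ext t
        have e : ∫ τ, f k τ * η t * chr (t * τ) = g t * ∫ τ, f k τ * chr (t * τ) := by
          rw [← integral_const_mul]
          refine integral_congr_ae (.of_forall fun τ => ?_)
          simp only [hηg]
          ring
        rw [Complex.real_smul, mul_left_comm, e]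

lemma measurable_uncurry_freq {E : Type*} [MeasurableSpace E] {f : ℤ → ℝ → E}
    (hf : ∀ k, Measurable (f k)) : Measurable fun q : ℤ × ℝ => f q.1 q.2 :=
  measurable_from_prod_countable_right hf

lemma measurable_intCast_fst : Measurable fun q : ℤ × ℝ => (q.1 : ℝ) :=
  (measurable_of_countable _).comp measurable_fst

/-- The constant of Fourier inversion on `𝕋_L × ℝ`. -/
def invConst (L : ℝ) : ℝ := (2 * Real.pi * (2 * Real.pi * L))⁻¹

/-- For almost every `t` the slice has the absolutely summable Fourier coefficients found by
inversion in time, so its Fourier series represents it. -/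
theorem ae_eq_fourier_inversion {L : ℝ} (hL : 0 < L) {v : ℝ × ℝ → ℂ}
    (hv : MemLp v 2 ((periodMeasure L).prod volume)) {f : ℤ → ℝ → ℂ}
    (hf : HasFourier L (ofFun L v) f) (hm : ∀ k, Measurable (f k))
    (hi : Integrable (fun q : ℤ × ℝ => f q.1 q.2) freqMeasure) :
    ∀ᵐ p ∂(periodMeasure L).prod volume, v p = invConst L *
      ∫ q, f q.1 q.2 * chr (p.1 * (q.1 / L) + p.2 * q.2) ∂freqMeasure := by
  -- A strongly measurable representative has measurable slices and a measurable equality set, which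
  -- the final exchange of the two almost-everywhere quantifiers needs.
  wlog hvm : StronglyMeasurable v generalizing v
  · have hae := hv.1.ae_eq_mk
    have h := this (v := hv.1.mk v) (hv.ae_eq hae) ?_ hv.1.stronglyMeasurable_mk
    · filter_upwards [h, hae] with p h1 h2
      rw [h2, h1]
    · have e : ofFun L (hv.1.mk v) = ofFun L v := by
        funext φ
        rw [ofFun, ofFun, restrict_strip]
        refine integral_congr_ae ?_
        filter_upwards [hae] with p hp
        rw [hp]
      rw [e]
      exact hf
  have hik : ∀ k, Integrable (f k) := Measure.ae_count_iff.1 hi.prod_right_ae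
  have hsum : Summable fun k => ∫ τ, ‖f k τ‖ := by
    have h := integrable_count_iff.1 hi.norm.integral_prod_left
    refine h.congr fun k => ?_
    exact Real.norm_of_nonneg (integral_nonneg fun _ => norm_nonneg _)
  have hint : ∀ x t : ℝ, Integrable
      (fun q : ℤ × ℝ => f q.1 q.2 * chr (x * (q.1 / L) + t * q.2)) freqMeasure := by
    intro x t
    have := measurable_intCast_fst
    exact integrable_mul_chr hi (φ := fun q : ℤ × ℝ => x * (q.1 / L) + t * q.2) (by fun_prop)
  have hslice : ∀ᵐ t : ℝ, ∀ᵐ x ∂periodMeasure L, v (x, t) = invConst L *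
      ∫ q, f q.1 q.2 * chr (x * (q.1 / L) + t * q.2) ∂freqMeasure := by
    have h1 : ∀ᵐ t : ℝ, ∀ k : ℤ, ∫ x, v (x, t) * chr (-(x * (k / L))) ∂(periodMeasure L) =
        (2 * Real.pi : ℂ)⁻¹ * ∫ τ : ℝ, f k τ * chr (t * τ) :=
      ae_all_iff.2 fun k => ae_integral_slice_eq hv hf k (hik k)
    have h2 : ∀ᵐ t : ℝ, Integrable (fun x => ‖v (x, t)‖ ^ 2) (periodMeasure L) :=
      ((memLp_two_iff_integrable_sq_norm hv.1).1 hv).prod_left_ae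
    filter_upwards [h1, h2] with t h1 h2
    have hmem : MemLp (fun x => v (x, t)) 2 (periodMeasure L) :=
      (memLp_two_iff_integrable_sq_norm
        (hvm.comp_measurable measurable_prodMk_right).aestronglyMeasurable).2 h2
    have h3 := ae_eq_tsum_chr hL hmem
      (c := fun k => (invConst L : ℂ) * ∫ τ : ℝ, f k τ * chr (t * τ)) (fun k => ?_) ?_
    · filter_upwards [h3] with x hx
      rw [hx, integral_prod _ (hint x t), integral_countable (hint x t).integral_prod_left,
        ← tsum_mul_left]
      congr 1
      ext k
      simp only [Measure.real, Measure.count_singleton, ENNReal.toReal_one, one_smul]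
      rw [mul_assoc, ← integral_mul_const]
      congr 1
      refine integral_congr_ae (.of_forall fun τ => ?_)
      simp only [chr_add]
      ring
    · rw [h1 k, invConst]
      have : (L : ℂ) ≠ 0 := by exact_mod_cast hL.ne'
      have : (Real.pi : ℂ) ≠ 0 := by exact_mod_cast Real.pi_ne_zero
      push_cast
      field_simp
    · refine Summable.of_nonneg_of_le (fun _ => norm_nonneg _) (fun k => ?_)
        (hsum.mul_left ‖(invConst L : ℂ)‖)
      rw [norm_mul]
      gcongr
      refine (norm_integral_le_integral_norm _).trans (le_of_eq ?_)
      refine integral_congr_ae (.of_forall fun τ => ?_)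
      simp only [norm_mul, norm_chr, mul_one]
  have hS : StronglyMeasurable fun p : ℝ × ℝ => (invConst L : ℂ) *
      ∫ q, f q.1 q.2 * chr (p.1 * (q.1 / L) + p.2 * q.2) ∂freqMeasure := by
    refine StronglyMeasurable.const_mul ?_ _
    refine StronglyMeasurable.integral_prod_right
      (f := fun (p : ℝ × ℝ) (q : ℤ × ℝ) => f q.1 q.2 * chr (p.1 * (q.1 / L) + p.2 * q.2)) ?_
    apply Measurable.stronglyMeasurable
    have hsnd : Measurable (Prod.snd : (ℝ × ℝ) × (ℤ × ℝ) → ℤ × ℝ) := measurable_snd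
    have h1 := (measurable_uncurry_freq hm).comp hsnd
    have h2 := measurable_intCast_fst.comp hsnd
    refine h1.mul (continuous_chr.measurable.comp ?_)
    refine Measurable.add (Measurable.mul (by fun_prop) (h2.div_const _)) (by fun_prop)
  have hmeas := measurableSet_eq_fun hvm.measurable hS.measurable
  rw [Measure.ae_prod_iff_ae_ae hmeas]
  exact (Measure.ae_ae_comm (p := fun x t => v (x, t) = invConst L *
      ∫ q, f q.1 q.2 * chr (x * (q.1 / L) + t * q.2) ∂freqMeasure) hmeas).2 hslice

/-! ### The Fourier transform of the derivative of a product -/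

/-- For `s > 1/2`, the `L²_ξ L¹_τ` norm with weight `⟨ξ⟩ ^ s` controls the `L¹` norm. -/
lemma integrable_of_normL2L1_lt_top {L a s : ℝ} (hL : 1 ≤ L) (hs : 1 / 2 < s) {f : ℤ → ℝ → ℂ}
    (hm : ∀ k, Measurable (f k)) (hf : normL2L1 L a s 0 f < ⊤) :
    Integrable (fun q : ℤ × ℝ => f q.1 q.2) freqMeasure := by
  have hL0 : 0 < L := by linarith
  have hmeas := measurable_uncurry_freq hm
  refine ⟨hmeas.aestronglyMeasurable, ?_⟩
  unfold HasFiniteIntegral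
  rw [lintegral_prod _ hmeas.enorm.aemeasurable, lintegral_count]
  simp only
  set ω := ENNReal.ofReal (2 * Real.pi * L)⁻¹ with hω
  have hω0 : ω ≠ 0 := by
    rw [hω, ne_eq, ENNReal.ofReal_eq_zero, not_le]
    positivity
  obtain ⟨C, -, hC⟩ := tsum_bracket_le (p := 2 * s) (by linarith)
  have h1 : ∑' k : ℤ, ω * ENNReal.ofReal (bracket (k / L) ^ (-s)) ^ 2 < ⊤ := by
    refine lt_of_le_of_lt ?_ (ENNReal.ofReal_lt_top (r := C))
    refine le_trans ?_ (hC L hL)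
    gcongr with k
    · rw [hω]
      apply ENNReal.ofReal_le_ofReal
      gcongr
      have := Real.pi_gt_three
      nlinarith
    · apply le_of_eq
      have := bracket_pos ((k : ℝ) / L)
      rw [← ENNReal.ofReal_pow (by positivity), ← Real.rpow_two, ← Real.rpow_mul this.le]
      ring_nf
  have h2 : ∑' k : ℤ, ω * (∫⁻ τ, weighted L a s 0 f k τ) ^ 2 < ⊤ := by
    unfold normL2L1 at hf
    by_contra h
    rw [not_lt, top_le_iff] at h
    rw [← hω, h, ENNReal.top_rpow_of_pos (by norm_num)] at hf
    exact lt_irrefl _ hf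
  have h3 := (tsum_mul_sq_le ω (fun k : ℤ => ENNReal.ofReal (bracket (k / L) ^ (-s)))
    (fun k => ∫⁻ τ, weighted L a s 0 f k τ)).trans_lt (ENNReal.mul_lt_top h1 h2)
  have h4 : ∀ k : ℤ, ENNReal.ofReal (bracket (k / L) ^ (-s)) * (∫⁻ τ, weighted L a s 0 f k τ) =
      ∫⁻ τ, ‖f k τ‖ₑ := by
    intro k
    rw [← lintegral_const_mul _ (measurable_weighted (hm k))]
    refine lintegral_congr fun τ => ?_
    have := bracket_pos ((k : ℝ) / L)
    rw [weighted_eq, Real.rpow_zero, ENNReal.ofReal_one, one_mul, ← mul_assoc,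
      ← ENNReal.ofReal_mul (by positivity), ← Real.rpow_add this]
    simp
  simp only [h4, ENNReal.tsum_mul_left] at h3
  by_contra h
  rw [not_lt, top_le_iff] at h
  rw [h, ENNReal.mul_top hω0] at h3
  simp at h3

/-- The Fourier transform of `∂ₓ (v₁ v₂)` in terms of those of `v₁` and `v₂`. -/
def convFourier (L : ℝ) (f₁ f₂ : ℤ → ℝ → ℂ) (k : ℤ) (τ : ℝ) : ℂ :=
  Complex.I * ((k / L : ℝ) : ℂ) * ((invConst L : ℝ) : ℂ) *
    ∫ q, f₁ (k - q.1) (τ - q.2) * f₂ q.1 q.2 ∂freqMeasure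

lemma enorm_convFourier_le {L : ℝ} (hL : 0 < L) {f₁ f₂ : ℤ → ℝ → ℂ}
    (h₁ : ∀ k, Measurable (f₁ k)) (h₂ : ∀ k, Measurable (f₂ k)) (k : ℤ) (τ : ℝ) :
    ‖convFourier L f₁ f₂ k τ‖ₑ ≤ ENNReal.ofReal |(k : ℝ) / L| *
      ∑' j, ENNReal.ofReal (2 * Real.pi * L)⁻¹ *
        lconv (fun σ => ‖f₁ (k - j) σ‖ₑ) (fun σ => ‖f₂ j σ‖ₑ) τ := by
  have hm : Measurable fun q : ℤ × ℝ => f₁ (k - q.1) (τ - q.2) * f₂ q.1 q.2 :=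
    measurable_uncurry_freq (f := fun j σ => f₁ (k - j) (τ - σ) * f₂ j σ) fun j => by
      have := h₁ (k - j)
      have := h₂ j
      fun_prop
  unfold convFourier
  rw [enorm_mul, enorm_mul, enorm_mul, ENNReal.tsum_mul_left]
  have e1 : ‖Complex.I‖ₑ = 1 := by simp [enorm]
  have e2 : ‖((k / L : ℝ) : ℂ)‖ₑ = ENNReal.ofReal |(k : ℝ) / L| := by
    rw [← ofReal_norm, Complex.norm_real, Real.norm_eq_abs]
  have hc : 0 < invConst L := by unfold invConst; positivity
  -- The factor `(2π)⁻¹` of inversion in time is discarded.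
  have e3 : ‖((invConst L : ℝ) : ℂ)‖ₑ ≤ ENNReal.ofReal (2 * Real.pi * L)⁻¹ := by
    rw [← ofReal_norm, Complex.norm_real, Real.norm_eq_abs, abs_of_pos hc]
    apply ENNReal.ofReal_le_ofReal
    unfold invConst
    gcongr
    have := Real.pi_gt_three
    have : 0 < 2 * Real.pi * L := by positivity
    nlinarith
  rw [e1, e2, one_mul, mul_assoc]
  gcongr
  refine (enorm_integral_le_lintegral_enorm _).trans (le_of_eq ?_)
  rw [lintegral_prod _ hm.enorm.aemeasurable, lintegral_count]
  simp only [enorm_mul, lconv]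

lemma integrable_conv {f₁ f₂ : ℤ → ℝ → ℂ}
    (h₁ : ∀ k, Measurable (f₁ k)) (h₂ : ∀ k, Measurable (f₂ k))
    (i₁ : Integrable (fun q : ℤ × ℝ => f₁ q.1 q.2) freqMeasure)
    (i₂ : Integrable (fun q : ℤ × ℝ => f₂ q.1 q.2) freqMeasure) (k : ℤ) :
    Integrable (fun p : (ℤ × ℝ) × ℝ => f₁ (k - p.1.1) (p.2 - p.1.2) * f₂ p.1.1 p.1.2)
      (freqMeasure.prod volume) := by
  have m₁ := measurable_uncurry_freq h₁
  have m₂ := measurable_uncurry_freq h₂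
  have hk : Measurable fun j : ℤ => k - j := measurable_of_countable _
  have m₁' : Measurable fun p : (ℤ × ℝ) × ℝ => f₁ (k - p.1.1) (p.2 - p.1.2) :=
    m₁.comp ((hk.comp (measurable_fst.comp measurable_fst)).prodMk
      (measurable_snd.sub (measurable_snd.comp measurable_fst)))
  have m₂' : Measurable fun p : (ℤ × ℝ) × ℝ => f₂ p.1.1 p.1.2 := m₂.comp measurable_fst
  have m : Measurable fun p : (ℤ × ℝ) × ℝ => f₁ (k - p.1.1) (p.2 - p.1.2) * f₂ p.1.1 p.1.2 :=
    m₁'.mul m₂'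
  refine ⟨m.aestronglyMeasurable, ?_⟩
  unfold HasFiniteIntegral
  have hb : ∀ j, ∫⁻ τ, ‖f₁ j τ‖ₑ ≤ ∫⁻ q, ‖f₁ q.1 q.2‖ₑ ∂freqMeasure := by
    intro j
    rw [lintegral_prod _ m₁.enorm.aemeasurable, lintegral_count]
    exact ENNReal.le_tsum j
  rw [lintegral_prod _ m.enorm.aemeasurable]
  calc ∫⁻ q, (∫⁻ τ, ‖f₁ (k - q.1) (τ - q.2) * f₂ q.1 q.2‖ₑ) ∂freqMeasure
      ≤ ∫⁻ q, (∫⁻ q', ‖f₁ q'.1 q'.2‖ₑ ∂freqMeasure) * ‖f₂ q.1 q.2‖ₑ ∂freqMeasure := by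
        refine lintegral_mono fun q => ?_
        simp only [enorm_mul]
        rw [lintegral_mul_const' _ _ enorm_ne_top,
          lintegral_sub_right_eq_self (fun τ => ‖f₁ (k - q.1) τ‖ₑ)]
        gcongr
        exact hb _
    _ = (∫⁻ q', ‖f₁ q'.1 q'.2‖ₑ ∂freqMeasure) * ∫⁻ q, ‖f₂ q.1 q.2‖ₑ ∂freqMeasure :=
        lintegral_const_mul _ m₂.enorm
    _ < ⊤ := ENNReal.mul_lt_top i₁.2 i₂.2

lemma integrable_mul_schwartz {X : Type*} [MeasurableSpace X] {μ : Measure X} {F : X → ℂ}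
    (hF : Integrable F μ) (ψ : 𝓢(ℝ, ℂ)) {φ : X → ℝ} (hφ : Measurable φ) :
    Integrable (fun x => F x * ψ (φ x)) μ := by
  obtain ⟨C, hC⟩ := ψ.decay 0 0
  refine hF.mul_bdd (c := C) (ψ.continuous.measurable.comp hφ).aestronglyMeasurable
    (.of_forall fun x => ?_)
  simpa using hC.2 (φ x)

lemma distDx_ofFun_fourierTest (L : ℝ) (u : ℝ × ℝ → ℂ) (k : ℤ) (ψ : 𝓢(ℝ, ℂ)) :
    distDx (ofFun L u) (fourierTest L k ψ) =
      Complex.I * ((k / L : ℝ) : ℂ) * ∫ p in strip L, u p * fourierTest L k ψ p := by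
  have hd : ∀ p : ℝ × ℝ, deriv (fun x : ℝ => fourierTest L k ψ (x, p.2)) p.1 =
      -(Complex.I * ((k / L : ℝ) : ℂ)) * fourierTest L k ψ p := by
    intro p
    simp only [fourierTest_apply]
    have h1 : HasDerivAt (fun x : ℝ => ((-(x * (k / L)) : ℝ) : ℂ))
        (((-(1 * (k / L)) : ℝ) : ℂ)) p.1 :=
      (((hasDerivAt_id p.1).mul_const (k / L)).neg).ofReal_comp
    have h2 := ((h1.const_mul Complex.I).cexp).mul_const (schwartzHat ψ p.2)
    refine h2.deriv.trans ?_
    unfold chr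
    push_cast
    ring
  unfold distDx ofFun
  simp_rw [hd]
  rw [← integral_neg, ← integral_const_mul]
  congr 1
  ext p
  ring

/-- Only `v₂` is expanded by inversion. Each character in its expansion shifts the test function for
`v₁` in both frequencies, and the pairing with `v₁` is then known from its own transform. -/
theorem hasFourier_distDx_mul {L : ℝ} (hL : 0 < L) {v₁ v₂ : ℝ × ℝ → ℂ}
    (hv₁ : MemLp v₁ 2 ((periodMeasure L).prod volume))
    (hv₂ : MemLp v₂ 2 ((periodMeasure L).prod volume)) {f₁ f₂ : ℤ → ℝ → ℂ}
    (hf₁ : HasFourier L (ofFun L v₁) f₁) (hf₂ : HasFourier L (ofFun L v₂) f₂)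
    (h₁ : ∀ k, Measurable (f₁ k)) (h₂ : ∀ k, Measurable (f₂ k))
    (i₁ : Integrable (fun q : ℤ × ℝ => f₁ q.1 q.2) freqMeasure)
    (i₂ : Integrable (fun q : ℤ × ℝ => f₂ q.1 q.2) freqMeasure) :
    HasFourier L (distDx (ofFun L fun p => v₁ p * v₂ p)) (convFourier L f₁ f₂) := by
  intro k
  have hΦ := integrable_conv h₁ h₂ i₁ i₂ k
  have hint : Integrable (convFourier L f₁ f₂ k) := hΦ.integral_prod_right.const_mul _
  refine ⟨hint.1, fun ψ => ⟨integrable_mul_schwartz hint ψ measurable_id, ?_⟩⟩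
  have hinv := ae_eq_fourier_inversion hL hv₂ hf₂ h₂ i₂
  have hI := integrable_mul_fourierTest hv₁ k ψ
  have hphase : Measurable fun z : (ℝ × ℝ) × (ℤ × ℝ) => z.1.1 * (z.2.1 / L) + z.1.2 * z.2.2 := by
    have h := measurable_intCast_fst.comp
      (measurable_snd : Measurable (Prod.snd : (ℝ × ℝ) × (ℤ × ℝ) → ℤ × ℝ))
    exact ((measurable_fst.comp measurable_fst).mul (h.div_const _)).add (by fun_prop)
  have hsw : Integrable (Function.uncurry fun (p : ℝ × ℝ) (q : ℤ × ℝ) =>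
      v₁ p * fourierTest L k ψ p * f₂ q.1 q.2 * chr (p.1 * (q.1 / L) + p.2 * q.2))
      (((periodMeasure L).prod volume).prod freqMeasure) :=
    integrable_mul_chr (hI.mul_prod i₂) hphase
  have inner : ∀ q : ℤ × ℝ, ∫ p, v₁ p * fourierTest L k ψ p * f₂ q.1 q.2 *
      chr (p.1 * (q.1 / L) + p.2 * q.2) ∂(periodMeasure L).prod volume =
      ∫ τ, f₁ (k - q.1) (τ - q.2) * f₂ q.1 q.2 * ψ τ := by
    intro q
    have h := ((hf₁ (k - q.1)).2 (SchwartzMap.compSubConstCLM ℂ (-q.2) ψ)).2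
    rw [ofFun, restrict_strip] at h
    calc ∫ p, v₁ p * fourierTest L k ψ p * f₂ q.1 q.2 *
          chr (p.1 * (q.1 / L) + p.2 * q.2) ∂(periodMeasure L).prod volume
        = (∫ p, v₁ p * fourierTest L (k - q.1) (SchwartzMap.compSubConstCLM ℂ (-q.2) ψ) p
            ∂(periodMeasure L).prod volume) * f₂ q.1 q.2 := by
          rw [← integral_mul_const]
          congr 1
          ext p
          rw [fourierTest_apply, fourierTest_apply, schwartzHat_translate, chr_add,
            show -(p.1 * (((k - q.1 : ℤ) : ℝ) / L)) = -(p.1 * (k / L)) + p.1 * (q.1 / L) by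
              push_cast; ring, chr_add]
          ring
      _ = (∫ τ, f₁ (k - q.1) (τ - q.2) * ψ τ) * f₂ q.1 q.2 := by
          rw [h, ← integral_sub_right_eq_self
            (fun τ => f₁ (k - q.1) τ * SchwartzMap.compSubConstCLM ℂ (-q.2) ψ τ) q.2]
          congr 2
          ext τ
          rw [SchwartzMap.compSubConstCLM_apply]
          congr 2
          ring
      _ = _ := by
          rw [← integral_mul_const]
          congr 1
          ext τ
          ring
  have hsw' : Integrable (Function.uncurry fun (q : ℤ × ℝ) (τ : ℝ) =>
      f₁ (k - q.1) (τ - q.2) * f₂ q.1 q.2 * ψ τ) (freqMeasure.prod volume) :=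
    integrable_mul_schwartz hΦ ψ measurable_snd
  have main : ∫ p in strip L, v₁ p * v₂ p * fourierTest L k ψ p = (invConst L : ℂ) *
      ∫ τ, (∫ q, f₁ (k - q.1) (τ - q.2) * f₂ q.1 q.2 ∂freqMeasure) * ψ τ := by
    rw [restrict_strip]
    calc ∫ p, v₁ p * v₂ p * fourierTest L k ψ p ∂(periodMeasure L).prod volume
        = ∫ p, (invConst L : ℂ) * ∫ q, v₁ p * fourierTest L k ψ p * f₂ q.1 q.2 *
            chr (p.1 * (q.1 / L) + p.2 * q.2) ∂freqMeasure ∂(periodMeasure L).prod volume := by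
          refine integral_congr_ae ?_
          filter_upwards [hinv] with p hp
          have e : ∫ q, v₁ p * fourierTest L k ψ p * f₂ q.1 q.2 *
              chr (p.1 * (q.1 / L) + p.2 * q.2) ∂freqMeasure = v₁ p * fourierTest L k ψ p *
              ∫ q, f₂ q.1 q.2 * chr (p.1 * (q.1 / L) + p.2 * q.2) ∂freqMeasure := by
            rw [← integral_const_mul]
            congr 1
            ext q
            ring
          rw [hp, e]
          ring
      _ = (invConst L : ℂ) * ∫ q : ℤ × ℝ, (∫ τ : ℝ, f₁ (k - q.1) (τ - q.2) * f₂ q.1 q.2 * ψ τ)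
            ∂freqMeasure := by
          rw [integral_const_mul, integral_integral_swap hsw]
          simp_rw [inner]
      _ = _ := by
          rw [integral_integral_swap hsw']
          simp_rw [integral_mul_const]
  rw [distDx_ofFun_fourierTest, main, ← mul_assoc, ← integral_const_mul]
  congr 1
  ext τ
  unfold convFourier
  ring

/-! ### The bilinear estimate -/

/-- `HasFourier` gives only almost-everywhere measurability for each `k`, whereas the convolutions
below are handled with genuinely measurable functions. -/
lemma exists_measurable_rep {L : ℝ} {T : Functional} {f : ℤ → ℝ → ℂ} (hf : HasFourier L T f) :
    ∃ g : ℤ → ℝ → ℂ, (∀ k, Measurable (g k)) ∧ HasFourier L T g ∧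
      (∀ a s b, normL2L2 L a s b g = normL2L2 L a s b f) ∧
      ∀ a s b, normL2L1 L a s b g = normL2L1 L a s b f := by
  have hae : ∀ k, (hf k).1.mk (f k) =ᵐ[volume] f k := fun k => (hf k).1.ae_eq_mk.symm
  refine ⟨fun k => (hf k).1.mk (f k), fun k => (hf k).1.stronglyMeasurable_mk.measurable,
    fun k => ⟨(hf k).1.stronglyMeasurable_mk.aestronglyMeasurable, fun ψ => ?_⟩, ?_, ?_⟩
  · have h : (fun τ => (hf k).1.mk (f k) τ * ψ τ) =ᵐ[volume] fun τ => f k τ * ψ τ := by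
      filter_upwards [hae k] with τ hτ
      rw [hτ]
    exact ⟨((hf k).2 ψ).1.congr h.symm, ((hf k).2 ψ).2.trans (integral_congr_ae h.symm)⟩
  · intro a s b
    unfold normL2L2
    congr! 4 with k
    refine lintegral_congr_ae ?_
    filter_upwards [hae k] with τ hτ
    simp only [weighted, hτ]
  · intro a s b
    unfold normL2L1
    congr! 5 with k
    refine lintegral_congr_ae ?_
    filter_upwards [hae k] with τ hτ
    simp only [weighted, hτ]

/-- The bound is required only at indices with finite `N i`, because integrability of the transforms
is deduced from finiteness of the norm. -/
lemma le_mul_iInf₂_of_lt_top {ι : Type*} {p : ι → Prop} {N : ι → ℝ≥0∞} {a c : ℝ≥0∞}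
    (hc : c ≠ ⊤) (hN : ⨅ (i) (_ : p i), N i < ⊤) (h : ∀ i, p i → N i < ⊤ → a ≤ c * N i) :
    a ≤ c * ⨅ (i) (_ : p i), N i := by
  rcases eq_or_ne c 0 with rfl | hc0
  · simp only [iInf_lt_iff] at hN
    obtain ⟨i, hi, hi'⟩ := hN
    simpa using h i hi hi'
  rw [← ENNReal.div_le_iff' hc0 hc]
  refine le_iInf₂ fun i hi => ?_
  rcases eq_or_ne (N i) ⊤ with h' | h'
  · rw [h']
    exact le_top
  · rw [ENNReal.div_le_iff' hc0 hc]
    exact h i hi (lt_top_iff_ne_top.2 h')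

/-- A bound for the kernel implies the bilinear estimate. -/
theorem normZ_distDx_mul_le {L α s : ℝ} (hL : 1 ≤ L) (hs : 1 / 2 < s) {D : ℝ≥0∞} (hDt : D ≠ ⊤)
    (hD : ∀ k : ℤ, ∑' j : ℤ, ENNReal.ofReal (2 * Real.pi * L)⁻¹ *
      ENNReal.ofReal (kernelSq α s (((k - j : ℤ) : ℝ) / L) ((j : ℝ) / L)) ≤ D)
    {v₁ v₂ : ℝ × ℝ → ℂ} (hv₁ : MemY L α s v₁) (hv₂ : MemY L α s v₂) :
    normZ L 1 s (distDx (ofFun L fun p => v₁ p * v₂ p)) ≤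
      convConst * D ^ (1 / 2 : ℝ) * normY L α s (ofFun L v₁) * normY L α s (ofFun L v₂) := by
  have hL0 : 0 < L := by linarith
  have hDr : D ^ (1 / 2 : ℝ) ≠ ⊤ := ENNReal.rpow_ne_top_of_nonneg (by norm_num) hDt
  have hc : convConst * D ^ (1 / 2 : ℝ) ≠ ⊤ := ENNReal.mul_ne_top convConst_lt_top.ne hDr
  refine le_mul_iInf₂_of_lt_top (ENNReal.mul_ne_top hc hv₁.2.2.ne) hv₂.2.2 fun f₂ hf₂ hN₂ => ?_
  rw [mul_right_comm]
  refine le_mul_iInf₂_of_lt_top (ENNReal.mul_ne_top hc hN₂.ne) hv₁.2.2 fun f₁ hf₁ hN₁ => ?_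
  rw [mul_right_comm]
  obtain ⟨g₁, m₁, hg₁, e₁, e₁'⟩ := exists_measurable_rep hf₁
  obtain ⟨g₂, m₂, hg₂, e₂, e₂'⟩ := exists_measurable_rep hf₂
  rw [← e₁, ← e₁'] at hN₁ ⊢
  rw [← e₂, ← e₂'] at hN₂ ⊢
  have i₁ := integrable_of_normL2L1_lt_top hL hs m₁ (le_add_self.trans_lt hN₁)
  have i₂ := integrable_of_normL2L1_lt_top hL hs m₂ (le_add_self.trans_lt hN₂)
  have w₁ := hv₁.2.1
  have w₂ := hv₂.2.1
  rw [restrict_strip] at w₁ w₂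
  refine (iInf₂_le _ (hasFourier_distDx_mul hL0 w₁ w₂ hg₁ hg₂ m₁ m₂ i₁ i₂)).trans ?_
  exact norm_conv_le hD m₁ m₂ (enorm_convFourier_le hL0 m₁ m₂)

/-- The regularity hypothesis below `s = 1` provides a type of `c` compatible with `s`, and
arbitrarily close to the minimal type index. -/
lemma exists_isOfType {c s δ ε : ℝ} (hδ : 0 < δ) (hε : 0 < ε)
    (hs : min 1 (1 / 2 + minimalTypeIndex c / 2 + ENNReal.ofReal δ) ≤ ENNReal.ofReal s)
    (hs1 : s < 1) :
    minimalTypeIndex c < 1 ∧ ∃ ν : ℝ, 0 ≤ ν ∧ IsOfType c ν ∧ 1 + ν < 2 * s ∧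
      1 + ν ≤ 2 * (1 / 2 + (minimalTypeIndex c).toReal / 2 + ε) := by
  set N := minimalTypeIndex c with hN
  have h1 : ENNReal.ofReal s < 1 := by simpa using hs1
  have h2 : 1 / 2 + N / 2 + ENNReal.ofReal δ ≤ ENNReal.ofReal s := by
    rcases min_le_iff.1 hs with h | h
    · exact absurd h (not_le.2 h1)
    · exact h
  have hNt : N ≠ ⊤ := by
    intro h
    rw [h, ENNReal.top_div_of_ne_top (by simp), add_top, top_add, top_le_iff] at h2
    exact ENNReal.ofReal_ne_top h2
  obtain ⟨n, hn0, hn⟩ : ∃ n : ℝ, 0 ≤ n ∧ N = ENNReal.ofReal n :=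
    ⟨N.toReal, ENNReal.toReal_nonneg, (ENNReal.ofReal_toReal hNt).symm⟩
  have hs0 : 1 / 2 + n / 2 + δ ≤ s := by
    have e : (1 / 2 + N / 2 + ENNReal.ofReal δ : ℝ≥0∞) = ENNReal.ofReal (1 / 2 + n / 2 + δ) := by
      rw [ENNReal.ofReal_add (by positivity) hδ.le, ENNReal.ofReal_add (by positivity)
        (by positivity), ENNReal.ofReal_div_of_pos two_pos, ENNReal.ofReal_div_of_pos two_pos, hn]
      simp
    rw [e] at h2
    -- `ENNReal.ofReal` truncates negative numbers to `0`; a nonpositive `s` is excluded because the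
    -- left side is positive.
    have hpos : 0 < s := by
      by_contra h
      rw [ENNReal.ofReal_of_nonpos (not_lt.1 h), nonpos_iff_eq_zero, ENNReal.ofReal_eq_zero] at h2
      linarith
    exact (ENNReal.ofReal_le_ofReal_iff hpos.le).1 h2
  have hn1 : n < 1 := by linarith
  have hirr : Irrational c := by
    by_contra h
    exact hNt (by rw [hN, minimalTypeIndex, if_neg h])
  -- The slack `2δ` gives `1 + ν < 2s`, and the slack `2ε` keeps `1 + ν` below twice the exponent of
  -- `L` in the estimate.
  have hlt : N < ENNReal.ofReal (n + min (2 * δ) (2 * ε)) := by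
    rw [hn]
    have : 0 < min (2 * δ) (2 * ε) := by positivity
    exact (ENNReal.ofReal_lt_ofReal_iff (by positivity)).2 (by linarith)
  have hlt' := hlt
  rw [hN, minimalTypeIndex, if_pos hirr, sInf_lt_iff] at hlt'
  obtain ⟨_, ⟨ν, ⟨hν0, hν⟩, rfl⟩, hν'⟩ := hlt'
  have h3 : ν < n + min (2 * δ) (2 * ε) :=
    (ENNReal.ofReal_lt_ofReal_iff_of_nonneg hν0.le).1 hν'
  have h4 := min_le_left (2 * δ) (2 * ε)
  have h5 := min_le_right (2 * δ) (2 * ε)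
  refine ⟨?_, ν, hν0.le, hν, by linarith, ?_⟩
  · rw [hn]
    simpa using hn1
  · rw [hn, ENNReal.toReal_ofReal hn0]
    linarith

lemma one_le_bilinearConst {α ε L : ℝ} (hε : 0 < ε) (hL : 1 ≤ L) : 1 ≤ bilinearConst α ε L := by
  unfold bilinearConst
  have : 0 ≤ (minimalTypeIndex (c₁ α)).toReal := ENNReal.toReal_nonneg
  split_ifs
  · exact Real.one_le_rpow hL (by positivity)
  · exact Real.one_le_rpow hL hε.le

end MajdaBiello

end

theorem mainTheorem6 (α s : ℝ) (hα₀ : 0 < α) (hα₁ : α < 1)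
    (hs : ∃ δ : ℝ, 0 < δ ∧
      min 1 (1 / 2 + MajdaBiello.minimalTypeIndex (MajdaBiello.c₁ α) / 2 + ENNReal.ofReal δ)
        ≤ ENNReal.ofReal s)
    (ε : ℝ) (hε : 0 < ε) :
    ∃ C : ℝ, 0 < C ∧ ∀ L : ℝ, 1 ≤ L → ∀ v₁ v₂ : ℝ × ℝ → ℂ,
      MajdaBiello.MemY L α s v₁ → MajdaBiello.MemY L α s v₂ →
        MajdaBiello.normZ L 1 s
            (MajdaBiello.distDx (MajdaBiello.ofFun L (fun p => v₁ p * v₂ p)))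
          ≤ ENNReal.ofReal (C * MajdaBiello.bilinearConst α ε L) *
            MajdaBiello.normY L α s (MajdaBiello.ofFun L v₁) *
            MajdaBiello.normY L α s (MajdaBiello.ofFun L v₂) := by
  open MajdaBiello in
  obtain ⟨δ, hδ, hs⟩ := hs
  obtain ⟨ν, hν⟩ : ∃ ν : ℝ, s < 1 → minimalTypeIndex (c₁ α) < 1 ∧ 0 ≤ ν ∧ IsOfType (c₁ α) ν ∧
      1 + ν < 2 * s ∧ 1 + ν ≤ 2 * (1 / 2 + (minimalTypeIndex (c₁ α)).toReal / 2 + ε) := by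
    by_cases h : s < 1
    · obtain ⟨h1, ν, h2⟩ := exists_isOfType hδ hε hs h
      exact ⟨ν, fun _ => ⟨h1, h2⟩⟩
    · exact ⟨0, fun h' => absurd h' h⟩
  have hs2 : 1 / 2 < s := by
    by_cases h : s < 1
    · obtain ⟨-, h1, -, h2, -⟩ := hν h
      linarith
    · linarith
  obtain ⟨C, hC, hker⟩ := tsum_kernelSq_le hα₀ hα₁ hs2
    (fun h => ⟨(hν h).2.1, (hν h).2.2.1, (hν h).2.2.2.1.le⟩)
  -- The kernel sum is bounded by `C * B ^ 2` and enters through its square root; the `+ 1` only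
  -- ensures positivity.
  refine ⟨convConst.toReal * Real.sqrt C + 1, by positivity, fun L hL v₁ v₂ hv₁ hv₂ => ?_⟩
  have hL0 : 0 < L := by linarith
  set B := bilinearConst α ε L with hB
  have hB1 : 1 ≤ B := one_le_bilinearConst hε hL
  have hΛ : s < 1 → L ^ (1 + ν) ≤ B ^ 2 := by
    intro h
    obtain ⟨h1, -, -, -, h2⟩ := hν h
    rw [hB, bilinearConst, if_pos h1, ← Real.rpow_two, ← Real.rpow_mul hL0.le, mul_comm _ (2 : ℝ)]
    exact Real.rpow_le_rpow_of_exponent_le hL h2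
  have hD : ∀ k : ℤ, ∑' j : ℤ, ENNReal.ofReal (2 * Real.pi * L)⁻¹ *
      ENNReal.ofReal (kernelSq α s (((k - j : ℤ) : ℝ) / L) ((j : ℝ) / L)) ≤
        ENNReal.ofReal (C * B ^ 2) := by
    intro k
    refine le_trans ?_ (hker L hL (B ^ 2) (one_le_pow₀ hB1) hΛ k)
    gcongr
    have := Real.pi_gt_three
    nlinarith
  refine (normZ_distDx_mul_le hL hs2 ENNReal.ofReal_ne_top hD hv₁ hv₂).trans ?_
  gcongr
  rw [ENNReal.ofReal_rpow_of_nonneg (by positivity) (by norm_num), ← Real.sqrt_eq_rpow,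
    Real.sqrt_mul hC.le, Real.sqrt_sq (by linarith),
    ← ENNReal.ofReal_toReal convConst_lt_top.ne, ← ENNReal.ofReal_mul ENNReal.toReal_nonneg]
  apply ENNReal.ofReal_le_ofReal
  rw [ENNReal.toReal_ofReal ENNReal.toReal_nonneg, ← mul_assoc]
  gcongr
  linarith
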